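/- Let $\mathbf k$ be a field. For $n\ge 0$ let $\mathcal T(n)$ be the set of rooted (non-planar) trees with vertex set $[n]=\{1,\dots,n\}$ (so $\mathcal T(0)=\emptyset$), and for $T\in\mathcal T(n)$ let $\mathrm{In}(T,i)$ be the set of vertices $j$ whose edge towards the root ends at $i$. For $T\in\mathcal T(n)$, $S\in\mathcal T(m)$, $1\le i\le n$ and a map $f:\mathrm{In}(T,i)\to[m]$, let $T\circ_i^f S\in\mathcal T(n+m-1)$ be the tree obtained by substituting $S$ for the vertex $i$ of $T$: the outgoing edge of $i$, if there is one, becomes the outgoing edge of the root of $S$, each $j\in\mathrm{In}(T,i)$ is grafted on the vertex $f(j)$ of $S$, the labels of $S$ are raised by $i-1$, and the labels of $T$ greater than $i$ are raised by $m-1$. A non-symmetric operad over $\mathbf k$ consists of vector spaces $\mathcal P(n)$, $n\ge 0$, an element $1\in\mathcal P(1)$ and bilinear maps $\circ_i:\mathcal P(n)\times\mathcal P(m)\to\mathcal P(n+m-1)$, $1\le i\le n$, such that, for $a\in\mathcal P(n)$, $b\in\mathcal P(m)$, $c\in\mathcal P(\ell)$, $$(a\circ_i b)\circ_{i+j-1}c=a\circ_i(b\circ_j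 c)\ (1\le j\le m),\qquad (a\circ_i b)\circ_j c=(a\circ_j c)\circ_{i+\ell-1}b\ (j<i),\qquad 1\circ_1 a=a=a\circ_i 1 .$$ It is reduced if $\mathcal P(0)=0$ and $c\mapsto c\cdot 1$ is a bijection $\mathbf k\to\mathcal P(1)$. Morphisms are families of linear maps that preserve $1$ and all $\circ_i$. The pre-Lie operad, with its symmetric group actions forgotten, is the collection $\mathcal{PL}(n)=\mathbf k\mathcal T(n)$ with unit the one-vertex tree and composition given on trees by $T\circ_i S=\sum_{f:\mathrm{In}(T,i)\to[m]}T\circ_i^f S$. Let $f_{\mathrm{Max}}:\mathrm{In}(T,i)\to[m]$ be the map with $f_{\mathrm{Max}}(j)=m$ for $j<i$ and $f_{\mathrm{Max}}(j)=1$ for $j>i$. A tree with at least two vertices is called $\mathcal T_{\mathrm{Max}}$-indecomposable if it is not of the form $T\circ_i^{f_{\mathrm{Max}}}S$ with trees $T,S$ that both have at least two vertices. **Theorem.** $\mathcal{PL}$ is a reduced non-symmetric operad, and it is the free non-symmetric operad on the $\mathcal T_{\mathrm{Max}}$-indecomposable trees: for every non-symmetric operad $\mathcal Q$ over $\mathbf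 k$ and every choice of an element $g(X)\in\mathcal Q(n)$ for each $n$ and each $\mathcal T_{\mathrm{Max}}$-indecomposable tree $X\in\mathcal T(n)$, there is a unique morphism of non-symmetric operads $\varphi:\mathcal{PL}\to\mathcal Q$ with $\varphi(X)=g(X)$ for all such $X$. -/

import Mathlib

universe u v w

/-! ### Labelled rooted trees -/

/-- A rooted tree with vertex set `V`, all edges oriented towards the root: `parent x` is the
outgoing vertex of `x` (`none` exactly at the root), and every vertex is joined to the root by an
oriented path. With `V = Fin n` these are the `n`-labelled rooted trees; the label `j` of the usual
convention `{1, …, n}` is `j - 1` here. -/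
@[ext]
structure LabelledTree (V : Type u) where
  parent : V → Option V
  root : V
  parent_root : parent root = none
  reaches : ∀ x, Relation.ReflTransGen (fun a b => parent a = some b) x root

namespace LabelledTree

variable {V : Type u} {W : Type v}

/-- The set of incoming vertices of the vertex `i`. -/
abbrev In (T : LabelledTree V) (i : V) : Type u := {j : V // T.parent j = some i}

/-- Transport of a rooted tree along a bijection of the labels. -/
def relabel (T : LabelledTree V) (e : V ≃ W) : LabelledTree W where
  parent x := (T.parent (e.symm x)).map e
  root := e T.root
  parent_root := by simp [T.parent_root]
  reaches x := by
    have h := Relation.ReflTransGen.lift (p := fun a b => (T.parent (e.symm a)).map e = some b) e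
      (fun a b (hab : T.parent a = some b) => by simp [Function.onFun, hab]) _ _ (T.reaches (e.symm x))
    simpa [Function.onFun] using h

/-- A vertex `b` of `T` seen in the tree obtained by substituting `S` for the vertex `i` of `T`;
the vertex `i` itself is sent to the root of `S`. -/
def outer [DecidableEq V] (i : V) (S : LabelledTree W) (b : V) : {a : V // a ≠ i} ⊕ W :=
  if h : b = i then Sum.inr S.root else Sum.inl ⟨b, h⟩

/-- The tree obtained from `T` by substituting the tree `S` for the vertex `i`: the outgoing vertex
of `i`, if there is one, becomes the outgoing vertex of the root of `S`, and each incoming vertex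
`j` of `i` is grafted on the vertex `f j` of `S`. -/
def substitute [DecidableEq V] (T : LabelledTree V) (i : V) (S : LabelledTree W) (f : T.In i → W) :
    LabelledTree ({a : V // a ≠ i} ⊕ W) where
  parent x := match x with
    | Sum.inl a =>
        if h : T.parent a = some i then some (Sum.inr (f ⟨a, h⟩))
        else (T.parent a).map (outer i S)
    | Sum.inr s =>
        match S.parent s with
        | some s' => some (Sum.inr s')
        | none => (T.parent i).map (outer i S)
  root := outer i S T.root
  parent_root := by
    by_cases h : T.root = i
    · have h1 : T.parent i = none := h ▸ T.parent_root
      simp [outer, h, S.parent_root, h1]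
    · simp [outer, h, T.parent_root]
  reaches := by
    set r : ({a : V // a ≠ i} ⊕ W) → ({a : V // a ≠ i} ⊕ W) → Prop := _
    change ∀ x, Relation.ReflTransGen r x _
    have hin : ∀ s, Relation.ReflTransGen r (Sum.inr s) (Sum.inr S.root) := fun s =>
      Relation.ReflTransGen.lift (p := r) Sum.inr
        (fun a b (hab : S.parent a = some b) => by simp [r, Function.onFun, hab]) _ _ (S.reaches s)
    have hout : ∀ b, Relation.ReflTransGen r (outer i S b) (outer i S T.root) := by
      intro b
      induction T.reaches b using Relation.ReflTransGen.head_induction_on with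
      | refl => exact Relation.ReflTransGen.refl
      | @head a c hac _ ih =>
        replace hac : T.parent a = some c := hac
        by_cases ha : a = i
        · subst ha
          refine Relation.ReflTransGen.head ?_ ih
          simp [r, outer, S.parent_root, hac]
        · by_cases hc : c = i
          · subst hc
            have h1 : r (outer c S a) (Sum.inr (f ⟨a, hac⟩)) := by
              simp [r, outer, ha, hac]
            refine Relation.ReflTransGen.head h1 ((hin _).trans ?_)
            simpa [outer] using ih
          · refine Relation.ReflTransGen.head ?_ ih
            simp [r, outer, ha, hac, hc]
    rintro (a | s)
    · simpa [outer, a.2] using hout a.1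
    · exact (hin s).trans (by simpa [outer] using hout i)

end LabelledTree

/-- The labelling of a substitution: the labels of the inner tree are shifted to the block
`i, …, i + m - 1`, and the labels of the outer tree greater than `i` are raised by `m - 1`.
(Labels start at `0`.) -/
def blockEquiv {n m p : ℕ} (h : n + m = p + 1) (i : Fin n) :
    {a : Fin n // a ≠ i} ⊕ Fin m ≃ Fin p where
  toFun x := match x with
    | Sum.inl a =>
        if ha : a.1 < i then ⟨a.1, by omega⟩
        else ⟨a.1 + m - 1, by
          have := a.1.2
          have := Fin.val_ne_of_ne a.2
          have : ¬ a.1.1 < i.1 := ha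
          omega⟩
    | Sum.inr s => ⟨i + s, by omega⟩
  invFun x :=
    if h1 : x.1 < i then Sum.inl ⟨⟨x, by omega⟩, fun e => by simp [← e] at h1⟩
    else if h2 : x.1 < i + m then Sum.inr ⟨x - i, by omega⟩
    else Sum.inl ⟨⟨x + 1 - m, by omega⟩, fun e => by
      have := congrArg Fin.val e
      simp at this
      omega⟩
  left_inv := by
    rintro (⟨⟨a, ha⟩, hai⟩ | ⟨s, hs⟩)
    · have hai' : a ≠ i.1 := fun e => hai (Fin.ext e)
      by_cases hlt : a < i.1
      · simp [Fin.lt_def, hlt]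
      · have h1 : ¬ a + m - 1 < i.1 := by omega
        have h2 : ¬ a + m - 1 < i.1 + m := by omega
        simp only [Fin.lt_def, hlt, h1, h2, dite_false, Sum.inl.injEq, Subtype.mk.injEq,
          Fin.mk.injEq]
        omega
    · simp [hs]
  right_inv := by
    rintro ⟨x, hx⟩
    by_cases h1 : x < i.1
    · simp [Fin.lt_def, h1]
    · by_cases h2 : x < i.1 + m
      · simp only [h1, h2, dite_false, dite_true, Fin.mk.injEq]
        omega
      · have h3 : ¬ x + 1 - m < i.1 := by omega
        simp only [h1, h2, Fin.lt_def, h3, dite_false, Fin.mk.injEq]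
        omega

namespace LabelledTree

variable {n m p : ℕ}

/-- The `p`-labelled rooted tree `T ∘_i^f S`, where `p = n + m - 1`. -/
def compAlong (h : n + m = p + 1) (T : LabelledTree (Fin n)) (i : Fin n) (S : LabelledTree (Fin m))
    (f : T.In i → Fin m) : LabelledTree (Fin p) :=
  (T.substitute i S f).relabel (blockEquiv h i)

/-- The map `f_Max`: the incoming vertices smaller than `i` go to the largest vertex of `S`, those
greater than `i` to the smallest vertex of `S`. -/
def fMax (T : LabelledTree (Fin n)) (i : Fin n) (S : LabelledTree (Fin m)) (j : T.In i) : Fin m :=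
  if j.1 < i then ⟨m - 1, by have := S.root.2; omega⟩ else ⟨0, by have := S.root.2; omega⟩

/-- The composition of the operad `T_Max`. -/
def maxComp (h : n + m = p + 1) (T : LabelledTree (Fin n)) (i : Fin n) (S : LabelledTree (Fin m)) :
    LabelledTree (Fin p) :=
  T.compAlong h i S (T.fMax i S)

/-- `X` is the result of a non-trivial composition in the operad `T_Max`. -/
def IsDecomposable (X : LabelledTree (Fin p)) : Prop :=
  ∃ (n m : ℕ) (h : n + m = p + 1) (T : LabelledTree (Fin n)) (i : Fin n) (S : LabelledTree (Fin m)),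
    1 < n ∧ 1 < m ∧ X = T.maxComp h i S

end LabelledTree

/-- The `T_Max`-indecomposable trees with `n ≥ 2` vertices. (The tree with one vertex is the unit
of `T_Max`; it is not counted as an indecomposable.) -/
def IndecomposableTree (n : ℕ) : Type :=
  {X : LabelledTree (Fin n) // 2 ≤ n ∧ ¬ X.IsDecomposable}

/-! ### Non-symmetric operads -/

/-- The data of a non-symmetric operad over `k`: graded vector space, unit and (bilinear) partial
compositions. `comp h i a b` is `a ∘_{i+1} b`; the arity `p = n + m - 1` of the result is
given by the equation `h`. The laws are in `OperadData.IsOperad`. -/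
structure OperadData (k : Type u) [Field k] where
  obj : ℕ → Type w
  [addCommGroup : ∀ n, AddCommGroup (obj n)]
  [module : ∀ n, Module k (obj n)]
  one : obj 1
  comp : ∀ {n m p : ℕ}, n + m = p + 1 → Fin n → obj n →ₗ[k] obj m →ₗ[k] obj p

attribute [instance] OperadData.addCommGroup OperadData.module

namespace OperadData

variable {k : Type u} [Field k]

/-- The laws of a non-symmetric operad. -/
structure IsOperad (P : OperadData.{u, w} k) : Prop where
  /-- `(a ∘_i b) ∘_{i+j-1} c = a ∘_i (b ∘_j c)` in the numbering from `1`. -/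
  assoc : ∀ {n m l p q r : ℕ} (hp : n + m = p + 1) (hr : p + l = r + 1)
    (hq : m + l = q + 1) (hr' : n + q = r + 1) (i : Fin n) (j : Fin m)
    (a : P.obj n) (b : P.obj m) (c : P.obj l),
    P.comp hr ⟨i + j, by omega⟩ (P.comp hp i a b) c = P.comp hr' i a (P.comp hq j b c)
  /-- `(a ∘_i b) ∘_j c = (a ∘_j c) ∘_{i+l-1} b` for `j < i` and `c` of arity `l`. -/
  comm : ∀ {n m l p q r : ℕ} (hp : n + m = p + 1) (hr : p + l = r + 1)
    (hq : n + l = q + 1) (hr' : q + m = r + 1) (i j : Fin n) (hji : j.1 < i.1)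
    (a : P.obj n) (b : P.obj m) (c : P.obj l),
    P.comp hr ⟨j, by omega⟩ (P.comp hp i a b) c =
      P.comp hr' ⟨i + l - 1, by omega⟩ (P.comp hq j a c) b
  one_comp : ∀ {n : ℕ} (h : 1 + n = n + 1) (a : P.obj n), P.comp h 0 P.one a = a
  comp_one : ∀ {n : ℕ} (h : n + 1 = n + 1) (i : Fin n) (a : P.obj n), P.comp h i a P.one = a

/-- An operad is reduced if `P(0) = 0` and `P(1) = k`. -/
structure IsReduced (P : OperadData.{u, w} k) : Prop where
  zero : Subsingleton (P.obj 0)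
  one : Function.Bijective (fun c : k => c • P.one)

/-- Morphisms of non-symmetric operads. -/
@[ext]
structure Hom (P : OperadData.{u, v} k) (Q : OperadData.{u, w} k) where
  app : ∀ n, P.obj n →ₗ[k] Q.obj n
  map_one : app 1 P.one = Q.one
  map_comp : ∀ {n m p : ℕ} (h : n + m = p + 1) (i : Fin n) (a : P.obj n) (b : P.obj m),
    app p (P.comp h i a b) = Q.comp h i (app n a) (app m b)

/-- `P` is a non-symmetric operad, and it is free on the family `ι` of its elements: every family of
elements of the same arities in a non-symmetric operad `Q` is the image of `ι` under exactly one
morphism of operads from `P` to `Q`. Equivalently, `P` is the free operad on the graded vector space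
with basis `X`. -/
def IsFreeOn (P : OperadData.{u, u} k) {X : ℕ → Type} (ι : ∀ n, X n → P.obj n) : Prop :=
  P.IsOperad ∧ ∀ Q : OperadData.{u, w} k, Q.IsOperad → ∀ g : ∀ n, X n → Q.obj n,
    ∃! φ : Hom P Q, ∀ n (x : X n), φ.app n (ι n x) = g n x

end OperadData

/-- The pre-Lie operad as a non-symmetric operad: the arity-`n` part has the `n`-labelled rooted
trees as a basis, and `T ∘_i S` is the sum of the trees `T ∘_i^f S` over all maps `f` from the
incoming vertices of `i` to the vertices of `S`. -/
noncomputable def preLie (k : Type u) [Field k] : OperadData.{u, u} k where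
  obj n := LabelledTree (Fin n) →₀ k
  one := Finsupp.single ⟨fun _ => none, 0, rfl, fun x => by
    rw [Subsingleton.elim x 0]⟩ 1
  comp {n m p} h i :=
    Finsupp.linearCombination k fun T : LabelledTree (Fin n) =>
      Finsupp.linearCombination k fun S : LabelledTree (Fin m) =>
        ∑ f : T.In i → Fin m, Finsupp.single (T.compAlong h i S f) 1

/-!
A tree `X` is a term of the pre-Lie composition `T ∘ᵢ S` exactly when contracting a block of
vertices of `X` gives `T` and restricting `X` to that block gives `S`. The operad axioms of `preLie`
therefore express the transitivity of contractions and restrictions.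

Order the trees by declaring that moving the target of an edge towards its source makes a tree
smaller. Among the terms of `T ∘ᵢ S` the tree along `fMax` is the largest, since its edges entering
the block end as far from their sources as possible, and it is monotone in `T` and `S`. The
compositions of `preLie` are thus unitriangular with respect to those of `T_Max`, which gives
uniqueness.

For existence, the values on trees are defined recursively so that each decomposable tree `X` has
one decomposition in `T_Max` whose pre-Lie composition is preserved. The blocks of two
decompositions of `X` are nested or disjoint, so the two have a common refinement. By induction on
the arity and on the order, associativity carries the preservation from one to the other.
-/

/-! ### Restrictions and contractions -/

namespace LabelledTree

variable {U : Type*} {V : Type*} {W : Type*}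

section Edge

/-- The edge relation of a rooted tree, oriented towards the root. -/
def Edge (X : LabelledTree V) (a b : V) : Prop :=
  X.parent a = some b

theorem Edge.unique {X : LabelledTree V} {a b c : V} (hb : X.Edge a b) (hc : X.Edge a c) :
    b = c :=
  Option.some_injective _ (hb.symm.trans hc)

theorem not_edge_root (X : LabelledTree V) (b : V) : ¬ X.Edge X.root b := by
  simp [Edge, X.parent_root]

theorem root_mem_of_closed (X : LabelledTree V) {C : Set V}
    (hC : ∀ a b, X.Edge a b → a ∈ C → b ∈ C) (hne : C.Nonempty) : X.root ∈ C := by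
  obtain ⟨a, ha⟩ := hne
  induction X.reaches a using Relation.ReflTransGen.head_induction_on with
  | refl => exact ha
  | head hac _ ih => exact ih (hC _ _ hac ha)

theorem exists_edge (X : LabelledTree V) {a : V} (ha : a ≠ X.root) : ∃ b, X.Edge a b := by
  by_contra! h
  have hroot : X.root = a :=
    X.root_mem_of_closed (C := {a}) (fun _ b hab hx => absurd (hx ▸ hab) (h b)) ⟨a, rfl⟩
  exact ha hroot.symm

theorem Edge.ne {X : LabelledTree V} {a b : V} (h : X.Edge a b) : a ≠ b := by
  rintro rfl
  have hroot : X.root = a := X.root_mem_of_closed (C := {a})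
    (fun _ _ hab hx => (hx ▸ hab).unique h) ⟨a, rfl⟩
  exact X.not_edge_root a (hroot.symm ▸ h)

theorem ext_of_edge_imp {X Y : LabelledTree V} (h : ∀ a b, X.Edge a b → Y.Edge a b) : X = Y := by
  have hroot : X.root = Y.root := by
    by_contra hne
    obtain ⟨b, hb⟩ := X.exists_edge (Ne.symm hne)
    exact Y.not_edge_root b (h _ _ hb)
  refine LabelledTree.ext (funext fun a => ?_) hroot
  by_cases ha : a = X.root
  · rw [ha, X.parent_root, hroot, Y.parent_root]
  · obtain ⟨b, hb⟩ := X.exists_edge ha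
    exact Eq.trans hb (h _ _ hb).symm

theorem exists_edge_iff {E : V → V → Prop} {r : V} (hunique : Relator.RightUnique E)
    (hroot : ∀ b, ¬ E r b) (hreach : ∀ a, Relation.ReflTransGen E a r) :
    ∃ X : LabelledTree V, ∀ a b, X.Edge a b ↔ E a b := by
  classical
  let parent (a : V) : Option V := if h : ∃ b, E a b then some h.choose else none
  have parent_eq_some (a b : V) : parent a = some b ↔ E a b := by
    by_cases ha : ∃ b, E a b
    · simp only [parent, dif_pos ha, Option.some.injEq]
      exact ⟨fun h => h ▸ ha.choose_spec, fun h => hunique ha.choose_spec h⟩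
    · simpa [parent, dif_neg ha] using fun h => ha ⟨b, h⟩
  exact ⟨⟨parent, r, dif_neg (by simpa using hroot),
    fun a => Relation.ReflTransGen.mono (fun a b => (parent_eq_some a b).2) _ _ (hreach a)⟩,
    parent_eq_some⟩

end Edge

section Connected

variable {X : LabelledTree V} {B : Set V} {x y : V}

/-- A vertex of the set `B` whose parent, if there is one, is outside `B`. -/
def IsTop (X : LabelledTree V) (B : Set V) (x : V) : Prop :=
  x ∈ B ∧ ∀ y, X.Edge x y → y ∉ B

/-- A set of vertices that spans a connected subgraph or is empty. Since every vertex of `B` lies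
below a top of `B`, this is encoded as the uniqueness of the top. -/
def IsConnected (X : LabelledTree V) (B : Set V) : Prop :=
  {x | X.IsTop B x}.Subsingleton

theorem Edge.isTop (h : X.Edge x y) (hx : x ∈ B) (hy : y ∉ B) : X.IsTop B x :=
  ⟨hx, fun _ hz => h.unique hz ▸ hy⟩

theorem isTop_root (h : X.root ∈ B) : X.IsTop B X.root :=
  ⟨h, fun _ hy => absurd hy (X.not_edge_root _)⟩

theorem exists_isTop (X : LabelledTree V) (hB : B.Nonempty) : ∃ x, X.IsTop B x := by
  by_contra! h
  refine h _ (isTop_root (X.root_mem_of_closed (fun a b hab ha => ?_) hB))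
  by_contra hb
  exact h a (hab.isTop ha hb)

theorem isConnected_of_subsingleton (hB : B.Subsingleton) : X.IsConnected B :=
  hB.anti fun _ hx => hx.1

end Connected

section Restriction

/-- The tree `S` is induced by `X` on the vertices in the image of `ι`. -/
def IsRestriction (ι : W → V) (X : LabelledTree V) (S : LabelledTree W) : Prop :=
  ∀ s t, S.Edge s t ↔ X.Edge (ι s) (ι t)

variable {ι : W → V} {X : LabelledTree V} {S S' : LabelledTree W}

theorem IsRestriction.unique (h : IsRestriction ι X S) (h' : IsRestriction ι X S') : S = S' :=
  ext_of_edge_imp fun s t hst => (h' s t).2 ((h s t).1 hst)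

theorem IsRestriction.comp_iff {κ : U → W} {R : LabelledTree U} (h : IsRestriction ι X S) :
    IsRestriction κ S R ↔ IsRestriction (ι ∘ κ) X R :=
  forall₂_congr fun a b => by rw [h]; rfl

theorem IsRestriction.eq_root_of_isTop (h : IsRestriction ι X S) {s : W}
    (hs : X.IsTop (Set.range ι) (ι s)) : s = S.root := by
  by_contra hne
  obtain ⟨t, ht⟩ := S.exists_edge hne
  exact hs.2 _ ((h s t).1 ht) ⟨t, rfl⟩

theorem IsRestriction.isConnected (h : IsRestriction ι X S) : X.IsConnected (Set.range ι) := by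
  rintro x hx y hy
  obtain ⟨⟨s, rfl⟩, -⟩ := id hx
  obtain ⟨⟨t, rfl⟩, -⟩ := id hy
  rw [h.eq_root_of_isTop hx, h.eq_root_of_isTop hy]

theorem IsConnected.exists_isRestriction [Nonempty W] (hι : Function.Injective ι)
    (hX : X.IsConnected (Set.range ι)) : ∃ S, IsRestriction ι X S := by
  obtain ⟨_, ⟨⟨r, rfl⟩, hr⟩⟩ := X.exists_isTop (Set.range_nonempty ι)
  have eq_r {s : W} (hs : X.IsTop (Set.range ι) (ι s)) : s = r := hι (hX hs ⟨⟨r, rfl⟩, hr⟩)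
  have reach (x : V) : ∀ s, ι s = x →
      Relation.ReflTransGen (fun s t => X.Edge (ι s) (ι t)) s r := by
    induction X.reaches x using Relation.ReflTransGen.head_induction_on with
    | refl =>
      rintro s hs
      have hs' : X.IsTop (Set.range ι) (ι s) := hs ▸ isTop_root ⟨s, hs⟩
      rw [eq_r hs']
    | @head _ c hac _ ih =>
      rintro s rfl
      by_cases hc : c ∈ Set.range ι
      · obtain ⟨t, rfl⟩ := hc
        exact (ih t rfl).head hac
      · rw [eq_r (Edge.isTop hac ⟨s, rfl⟩ hc)]
  exact exists_edge_iff (fun _ _ _ h h' => hι (h.unique h')) (fun t ht => hr _ ht ⟨t, rfl⟩)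
    fun s => reach _ s rfl

end Restriction

section Contraction

/-- The tree `T` arises from `X` by identifying the vertices in each fibre of `π` and deleting the
resulting loops. -/
def IsContraction (π : V → W) (X : LabelledTree V) (T : LabelledTree W) : Prop :=
  ∀ a b, T.Edge a b ↔ a ≠ b ∧ Relation.Map X.Edge π π a b

variable {π : V → W} {X : LabelledTree V} {T T' : LabelledTree W}

theorem IsContraction.edge (h : IsContraction π X T) {x y : V} (hxy : X.Edge x y)
    (hne : π x ≠ π y) : T.Edge (π x) (π y) :=
  (h _ _).2 ⟨hne, x, y, hxy, rfl, rfl⟩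

theorem IsContraction.unique (h : IsContraction π X T) (h' : IsContraction π X T') : T = T' :=
  ext_of_edge_imp fun a b hab => (h' a b).2 ((h a b).1 hab)

theorem isContraction_id : IsContraction id X X := fun a b =>
  ⟨fun h => ⟨h.ne, a, b, h, rfl, rfl⟩, by rintro ⟨-, _, _, h, rfl, rfl⟩; exact h⟩

theorem IsContraction.comp_iff {ρ : W → U} {A : LabelledTree U} (h : IsContraction π X T) :
    IsContraction ρ T A ↔ IsContraction (ρ ∘ π) X A := by
  refine forall₂_congr fun a b => iff_congr Iff.rfl (and_congr_right fun hab => ⟨?_, ?_⟩)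
  · rintro ⟨_, _, hcd, rfl, rfl⟩
    obtain ⟨-, x, y, hxy, rfl, rfl⟩ := (h _ _).1 hcd
    exact ⟨x, y, hxy, rfl, rfl⟩
  · rintro ⟨x, y, hxy, rfl, rfl⟩
    exact ⟨_, _, h.edge hxy fun e => hab (congrArg ρ e), rfl, rfl⟩

theorem IsContraction.isConnected_preimage (h : IsContraction π X T) {B : Set W}
    (hfib : ∀ a ∈ B, X.IsConnected (π ⁻¹' {a})) (hB : T.IsConnected B) :
    X.IsConnected (π ⁻¹' B) := by
  have isTop_fiber {x : V} (hx : X.IsTop (π ⁻¹' B) x) : X.IsTop (π ⁻¹' {π x}) x :=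
    ⟨rfl, fun y hxy hy => hx.2 y hxy (by rw [Set.mem_preimage, show π y = π x from hy]; exact hx.1)⟩
  have isTop_map {x : V} (hx : X.IsTop (π ⁻¹' B) x) : T.IsTop B (π x) := by
    refine ⟨hx.1, fun b hb hbB => ?_⟩
    obtain ⟨hne, u, v, huv, hu, rfl⟩ := (h _ _).1 hb
    obtain rfl : u = x := hfib _ hx.1 (huv.isTop hu (Ne.symm hne)) (isTop_fiber hx)
    exact hx.2 v huv hbB
  intro x hx y hy
  have hxy : π x = π y := hB (isTop_map hx) (isTop_map hy)
  exact hfib _ hx.1 (isTop_fiber hx) (hxy ▸ isTop_fiber hy)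

theorem exists_isContraction (hπ : Function.Surjective π)
    (hfib : ∀ a, X.IsConnected (π ⁻¹' {a})) : ∃ T, IsContraction π X T := by
  refine exists_edge_iff (r := π X.root) ?_ ?_ ?_
  · rintro a _ _ ⟨hb, x, y, hxy, hx, rfl⟩ ⟨hc, x', y', hxy', hx', rfl⟩
    obtain rfl := hfib a (hxy.isTop hx hb.symm) (hxy'.isTop hx' hc.symm)
    rw [hxy.unique hxy']
  · rintro _ ⟨hb, x, y, hxy, hx, rfl⟩
    obtain rfl := hfib _ (hxy.isTop hx hb.symm) (isTop_root rfl)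
    exact X.not_edge_root y hxy
  · rw [hπ.forall]
    intro x
    induction X.reaches x using Relation.ReflTransGen.head_induction_on with
    | refl => exact .refl
    | @head x y hxy _ ih =>
      by_cases hne : π x = π y
      · rwa [hne]
      · exact ih.head ⟨hne, x, y, hxy, rfl, rfl⟩

theorem IsContraction.base_change {U' : Type*} {ι : U → V} {ι' : U' → W} {ρ : U → U'}
    (hι' : Function.Injective ι') (hsq : π ∘ ι = ι' ∘ ρ)
    (hcart : ∀ x, π x ∈ Set.range ι' → x ∈ Set.range ι) {Z : LabelledTree U} {B : LabelledTree U'}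
    (hT : IsContraction π X T) (hZ : IsRestriction ι X Z) :
    IsContraction ρ Z B ↔ IsRestriction ι' T B := by
  have hsq' (u : U) : π (ι u) = ι' (ρ u) := congrFun hsq u
  refine forall₂_congr fun a b => iff_congr Iff.rfl ?_
  rw [hT, hι'.ne_iff]
  refine and_congr_right fun _ => ⟨?_, ?_⟩
  · rintro ⟨u, v, huv, rfl, rfl⟩
    exact ⟨ι u, ι v, (hZ u v).1 huv, hsq' u, hsq' v⟩
  · rintro ⟨x, y, hxy, hx, hy⟩
    obtain ⟨u, rfl⟩ := hcart x ⟨a, hx.symm⟩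
    obtain ⟨v, rfl⟩ := hcart y ⟨b, hy.symm⟩
    exact ⟨u, v, (hZ u v).2 hxy, hι' (by rw [← hsq', hx]), hι' (by rw [← hsq', hy])⟩

end Contraction

end LabelledTree

/-! ### Substitution of labelled trees -/

namespace LabelledTree

section Block

variable {U : Type*} {V : Type*} {W : Type*} {i : V}

/-- The map on vertices collapsing the copy of `W` in `(V ∖ {i}) ⊕ W ≃ U` to the vertex `i`. -/
def blockContr (e : {a : V // a ≠ i} ⊕ W ≃ U) (u : U) : V :=
  Sum.elim Subtype.val (fun _ => i) (e.symm u)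

/-- The inclusion of the block `W` in `(V ∖ {i}) ⊕ W ≃ U`. -/
def blockIncl (e : {a : V // a ≠ i} ⊕ W ≃ U) (w : W) : U :=
  e (Sum.inr w)

variable (e : {a : V // a ≠ i} ⊕ W ≃ U)

theorem blockContr_apply_inl (a : {a : V // a ≠ i}) : blockContr e (e (Sum.inl a)) = a := by
  simp [blockContr]

theorem blockContr_blockIncl (w : W) : blockContr e (blockIncl e w) = i := by
  simp [blockContr, blockIncl]

theorem blockIncl_injective : Function.Injective (blockIncl e) :=
  e.injective.comp Sum.inr_injective

variable {e}

theorem blockContr_eq_iff {u : U} : blockContr e u = i ↔ u ∈ Set.range (blockIncl e) := by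
  obtain ⟨a | w, rfl⟩ := e.surjective u
  · simp [blockContr_apply_inl, a.2, blockIncl]
  · exact iff_of_true (blockContr_blockIncl e w) ⟨w, rfl⟩

theorem eq_of_blockContr_eq {u v : U} (h : blockContr e u = blockContr e v)
    (hu : blockContr e u ≠ i) : u = v := by
  obtain ⟨a | w, rfl⟩ := e.surjective u
  · obtain ⟨b | w, rfl⟩ := e.surjective v
    · rw [blockContr_apply_inl, blockContr_apply_inl] at h
      rw [Subtype.ext h]
    · exact absurd (h.trans (blockContr_blockIncl e w)) hu
  · exact absurd (blockContr_blockIncl e w) hu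

theorem blockContr_surjective [Nonempty W] : Function.Surjective (blockContr e) := by
  intro a
  by_cases ha : a = i
  · exact ⟨blockIncl e (Classical.arbitrary W), by rw [blockContr_blockIncl, ha]⟩
  · exact ⟨_, blockContr_apply_inl e ⟨a, ha⟩⟩

/-- `X` arises from `T` by substituting `S` for the vertex `i` and grafting the incoming vertices
of `i` on some vertices of `S`. The bijection `e` names the vertices of the result. -/
structure IsComp (e : {a : V // a ≠ i} ⊕ W ≃ U) (T : LabelledTree V) (S : LabelledTree W)
    (X : LabelledTree U) : Prop where
  contraction : IsContraction (blockContr e) X T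
  restriction : IsRestriction (blockIncl e) X S

variable {T T' : LabelledTree V} {S S' : LabelledTree W} {X X' : LabelledTree U}

theorem IsComp.unique (h : T.IsComp e S X) (h' : T'.IsComp e S' X) : T = T' ∧ S = S' :=
  ⟨h.contraction.unique h'.contraction, h.restriction.unique h'.restriction⟩

theorem IsRestriction.isConnected_fiber (h : IsRestriction (blockIncl e) X S) (a : V) :
    X.IsConnected (blockContr e ⁻¹' {a}) := by
  by_cases ha : a = i
  · subst ha
    have hfib : blockContr e ⁻¹' {a} = Set.range (blockIncl e) :=
      Set.ext fun _ => blockContr_eq_iff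
    exact hfib ▸ h.isConnected
  · refine isConnected_of_subsingleton fun u hu v hv => ?_
    have hu : blockContr e u = a := hu
    exact eq_of_blockContr_eq (hu.trans (Eq.symm hv)) (hu ▸ ha)

theorem IsRestriction.exists_isComp (h : IsRestriction (blockIncl e) X S) :
    ∃ T : LabelledTree V, T.IsComp e S X :=
  have : Nonempty W := ⟨S.root⟩
  (exists_isContraction blockContr_surjective h.isConnected_fiber).imp fun _ hT => ⟨hT, h⟩

theorem IsRestriction.isComp_of_edge_imp (h : IsRestriction (blockIncl e) X S)
    (hT : ∀ a b, T.Edge a b → Relation.Map X.Edge (blockContr e) (blockContr e) a b) :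
    T.IsComp e S X := by
  obtain ⟨T', hT'⟩ := h.exists_isComp
  obtain rfl : T = T' := ext_of_edge_imp fun a b hab =>
    (hT'.contraction a b).2 ⟨hab.ne, hT a b hab⟩
  exact hT'

theorem isComp_iff_of_blockIncl_eq_id [Subsingleton V] {e : {a : V // a ≠ i} ⊕ W ≃ W}
    (he : blockIncl e = id) {X : LabelledTree W} : T.IsComp e S X ↔ X = S := by
  constructor
  · intro h
    exact ext_of_edge_imp fun s t hst => (h.restriction s t).2 (by rwa [he])
  · rintro rfl
    refine ⟨fun a b => ?_, fun s t => by rw [he, id, id]⟩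
    obtain rfl := Subsingleton.elim a b
    exact iff_of_false (fun hab => hab.ne rfl) (fun hab => hab.1 rfl)

theorem isComp_iff_of_blockContr_eq_id [Subsingleton W] {e : {a : V // a ≠ i} ⊕ W ≃ V}
    (he : blockContr e = id) {X : LabelledTree V} : T.IsComp e S X ↔ X = T := by
  constructor
  · intro h
    exact isContraction_id.unique (he ▸ h.contraction)
  · rintro rfl
    refine ⟨he ▸ isContraction_id, fun s t => ?_⟩
    obtain rfl := Subsingleton.elim s t
    exact iff_of_false (fun hab => hab.ne rfl) (fun hab => hab.ne rfl)

theorem IsComp.exists_edge_of_ne (h : T.IsComp e S X) (h' : T'.IsComp e S' X')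
    (hroot : S'.root = S.root) {x y : U} (hxy : X'.Edge x y)
    (hne : blockContr e x ≠ blockContr e y) {c : V} (hc : T.Edge (blockContr e x) c) :
    ∃ z, X.Edge x z ∧ blockContr e z = c := by
  obtain ⟨hne', x₀, z, hxz, hx₀, rfl⟩ := (h.contraction _ _).1 hc
  suffices x₀ = x from ⟨z, this ▸ hxz, rfl⟩
  by_cases hx : blockContr e x = i
  · obtain ⟨s, rfl⟩ := blockContr_eq_iff.1 hx
    obtain ⟨s₀, rfl⟩ := blockContr_eq_iff.1 (hx₀.trans hx)
    have hs : s = S'.root := h'.restriction.eq_root_of_isTop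
      (hxy.isTop ⟨s, rfl⟩ (mt blockContr_eq_iff.2 fun hy => hne (hx.trans hy.symm)))
    have hs₀ : s₀ = S.root := h.restriction.eq_root_of_isTop
      (hxz.isTop ⟨s₀, rfl⟩ (mt blockContr_eq_iff.2 fun hz => hne' (hx.trans hz.symm)))
    rw [hs, hs₀, hroot]
  · exact eq_of_blockContr_eq hx₀ (hx₀ ▸ hx)

end Block

section Nested

variable {U : Type*} {V : Type*} {W : Type*} {W' : Type*} {Y : Type*} {Z : Type*}
  {i : V} {j : W} {y : Y}

/-- Compatibility of the vertex names in `A ∘ (B ∘ C)` and `(A ∘ B) ∘ C`, where `e₁` names the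
vertices of the outer substitution and `e₃` those of `B ∘ C` on the left, and `e₂` and `e₄` those
of the outer substitution and of `A ∘ B` on the right. -/
structure IsNested (e₁ : {a : V // a ≠ i} ⊕ Z ≃ U) (e₂ : {a : Y // a ≠ y} ⊕ W' ≃ U)
    (e₃ : {a : W // a ≠ j} ⊕ W' ≃ Z) (e₄ : {a : V // a ≠ i} ⊕ W ≃ Y) : Prop where
  contr_contr : blockContr e₄ ∘ blockContr e₂ = blockContr e₁
  incl_incl : blockIncl e₁ ∘ blockIncl e₃ = blockIncl e₂
  contr_incl : blockContr e₂ ∘ blockIncl e₁ = blockIncl e₄ ∘ blockContr e₃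

variable {e₁ : {a : V // a ≠ i} ⊕ Z ≃ U} {e₂ : {a : Y // a ≠ y} ⊕ W' ≃ U}
  {e₃ : {a : W // a ≠ j} ⊕ W' ≃ Z} {e₄ : {a : V // a ≠ i} ⊕ W ≃ Y}
  {A : LabelledTree V} {B : LabelledTree W} {C : LabelledTree W'} {X : LabelledTree U}
  {AB : LabelledTree Y} {BC : LabelledTree Z}

theorem IsNested.preimage_range (he : IsNested e₁ e₂ e₃ e₄) :
    blockContr e₂ ⁻¹' Set.range (blockIncl e₄) = Set.range (blockIncl e₁) := by
  ext u
  rw [Set.mem_preimage, ← blockContr_eq_iff, ← blockContr_eq_iff, ← he.contr_contr,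
    Function.comp_apply]

theorem IsNested.isComp_outer (he : IsNested e₁ e₂ e₃ e₄) (hBC : B.IsComp e₃ C BC)
    (hX : A.IsComp e₁ BC X) (hX' : AB.IsComp e₂ C X) : A.IsComp e₄ B AB where
  contraction := hX'.contraction.comp_iff.2 (he.contr_contr ▸ hX.contraction)
  restriction :=
    (hX'.contraction.base_change (blockIncl_injective e₄) he.contr_incl
      he.preimage_range.le hX.restriction).1 hBC.contraction

theorem IsNested.exists_isComp_outer (he : IsNested e₁ e₂ e₃ e₄) (hBC : B.IsComp e₃ C BC)
    (hX : A.IsComp e₁ BC X) : ∃ AB : LabelledTree Y, A.IsComp e₄ B AB ∧ AB.IsComp e₂ C X := by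
  have hC : IsRestriction (blockIncl e₂) X C :=
    he.incl_incl ▸ hX.restriction.comp_iff.1 hBC.restriction
  obtain ⟨AB, hAB⟩ := hC.exists_isComp
  exact ⟨AB, he.isComp_outer hBC hX hAB, hAB⟩

theorem IsNested.exists_isComp_inner (he : IsNested e₁ e₂ e₃ e₄) (hAB : A.IsComp e₄ B AB)
    (hX : AB.IsComp e₂ C X) : ∃ BC : LabelledTree Z, B.IsComp e₃ C BC ∧ A.IsComp e₁ BC X := by
  have hconn : X.IsConnected (Set.range (blockIncl e₁)) :=
    he.preimage_range ▸ hX.contraction.isConnected_preimage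
      (fun a _ => hX.restriction.isConnected_fiber a) hAB.restriction.isConnected
  have : Nonempty Z := ⟨blockIncl e₃ C.root⟩
  obtain ⟨BC, hBC⟩ := hconn.exists_isRestriction (blockIncl_injective e₁)
  refine ⟨BC, ⟨?_, ?_⟩, ⟨?_, hBC⟩⟩
  · exact (hX.contraction.base_change (blockIncl_injective e₄) he.contr_incl
      he.preimage_range.le hBC).2 hAB.restriction
  · exact hBC.comp_iff.2 (he.incl_incl ▸ hX.restriction)
  · exact he.contr_contr ▸ hX.contraction.comp_iff.1 hAB.contraction

end Nested

section Disjoint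

variable {U : Type*} {V : Type*} {W : Type*} {W' : Type*} {Y : Type*} {Y' : Type*}
  {i j : V} {y : Y} {y' : Y'}

/-- Compatibility of the vertex names in `(A ∘ᵢ B) ∘ⱼ C` and `(A ∘ⱼ C) ∘ᵢ B`, where `e₁` and `e₂`
name the vertices of `A ∘ᵢ B` and of the substitution of `C` in it, and `e₃` and `e₄` those of
`A ∘ⱼ C` and of the substitution of `B` in it. -/
structure IsDisjoint (e₁ : {a : V // a ≠ i} ⊕ W ≃ Y) (e₂ : {a : Y // a ≠ y} ⊕ W' ≃ U)
    (e₃ : {a : V // a ≠ j} ⊕ W' ≃ Y') (e₄ : {a : Y' // a ≠ y'} ⊕ W ≃ U) : Prop where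
  ne : i ≠ j
  contr_contr : blockContr e₁ ∘ blockContr e₂ = blockContr e₃ ∘ blockContr e₄
  contr_incl : blockContr e₂ ∘ blockIncl e₄ = blockIncl e₁
  contr_incl' : blockContr e₄ ∘ blockIncl e₂ = blockIncl e₃

variable {e₁ : {a : V // a ≠ i} ⊕ W ≃ Y} {e₂ : {a : Y // a ≠ y} ⊕ W' ≃ U}
  {e₃ : {a : V // a ≠ j} ⊕ W' ≃ Y'} {e₄ : {a : Y' // a ≠ y'} ⊕ W ≃ U}
  {A : LabelledTree V} {B : LabelledTree W} {C : LabelledTree W'} {X : LabelledTree U}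
  {AB : LabelledTree Y} {AC : LabelledTree Y'}

theorem IsDisjoint.symm (he : IsDisjoint e₁ e₂ e₃ e₄) : IsDisjoint e₃ e₄ e₁ e₂ :=
  ⟨he.ne.symm, he.contr_contr.symm, he.contr_incl', he.contr_incl⟩

theorem IsDisjoint.preimage_range (he : IsDisjoint e₁ e₂ e₃ e₄) [Nonempty W] :
    blockContr e₂ ⁻¹' Set.range (blockIncl e₁) = Set.range (blockIncl e₄) := by
  ext u
  constructor
  · intro hu
    let w : W := Classical.arbitrary W
    have hcollapse (x : U) : blockContr e₁ (blockContr e₂ x) = blockContr e₃ (blockContr e₄ x) :=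
      congrFun he.contr_contr x
    have hw : blockContr e₃ (blockContr e₄ (blockIncl e₄ w)) = i := by
      rw [← hcollapse, show blockContr e₂ (blockIncl e₄ w) = blockIncl e₁ w from
        congrFun he.contr_incl w, blockContr_blockIncl]
    have hu' : blockContr e₃ (blockContr e₄ u) = i := by
      rw [← hcollapse, blockContr_eq_iff.2 hu]
    have huw : blockContr e₄ u = blockContr e₄ (blockIncl e₄ w) :=
      eq_of_blockContr_eq (hu'.trans hw.symm) (hu' ▸ he.ne)
    exact blockContr_eq_iff.1 (huw.trans (blockContr_blockIncl e₄ w))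
  · rintro ⟨w, rfl⟩
    exact ⟨w, (congrFun he.contr_incl w).symm⟩

theorem IsDisjoint.isRestriction (he : IsDisjoint e₁ e₂ e₃ e₄)
    (hAB : IsRestriction (blockIncl e₁) AB B) (hX : AB.IsComp e₂ C X) :
    IsRestriction (blockIncl e₄) X B := by
  have : Nonempty W := ⟨B.root⟩
  have hconn : X.IsConnected (Set.range (blockIncl e₄)) :=
    he.preimage_range ▸ hX.contraction.isConnected_preimage
      (fun a _ => hX.restriction.isConnected_fiber a) hAB.isConnected
  obtain ⟨B', hB'⟩ := hconn.exists_isRestriction (blockIncl_injective e₄)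
  have hid : IsContraction id B' B :=
    (hX.contraction.base_change (blockIncl_injective e₁) he.contr_incl
      he.preimage_range.le hB').2 hAB
  exact hid.unique isContraction_id ▸ hB'

theorem IsDisjoint.isComp (he : IsDisjoint e₁ e₂ e₃ e₄) (hAB : A.IsComp e₁ B AB)
    (hX : AB.IsComp e₂ C X) (hX' : AC.IsComp e₄ B X) : A.IsComp e₃ C AC where
  contraction :=
    hX'.contraction.comp_iff.2 (he.contr_contr ▸ hX.contraction.comp_iff.1 hAB.contraction)
  restriction :=
    have : Nonempty W' := ⟨C.root⟩
    (hX'.contraction.base_change (blockIncl_injective e₃) he.contr_incl'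
      he.symm.preimage_range.le hX.restriction).1 isContraction_id

theorem IsDisjoint.exists_isComp (he : IsDisjoint e₁ e₂ e₃ e₄) (hAB : A.IsComp e₁ B AB)
    (hX : AB.IsComp e₂ C X) : ∃ AC : LabelledTree Y', A.IsComp e₃ C AC ∧ AC.IsComp e₄ B X := by
  obtain ⟨AC, hAC⟩ := (he.isRestriction hAB.restriction hX).exists_isComp
  exact ⟨AC, he.isComp hAB hX hAC, hAC⟩

end Disjoint

section Substitution

variable {U : Type*} {V : Type*} {W : Type*}

theorem edge_relabel_iff {X : LabelledTree V} {e : V ≃ U} {a b : V} :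
    (X.relabel e).Edge (e a) (e b) ↔ X.Edge a b := by
  simp [Edge, relabel]

variable [DecidableEq V] {T : LabelledTree V} {i : V} {S : LabelledTree W} {f : T.In i → W}

theorem Edge.substitute_inr {s t : W} (h : S.Edge s t) :
    (T.substitute i S f).Edge (Sum.inr s) (Sum.inr t) := by
  unfold Edge at h ⊢
  simp only [substitute, h]

theorem edge_substitute_of_in (j : T.In i) :
    (T.substitute i S f).Edge (outer i S j) (Sum.inr (f j)) := by
  simp [Edge, substitute, outer, dif_neg (Edge.ne j.2), dif_pos j.2]

theorem Edge.substitute_outer {a b : V} (h : T.Edge a b) (hb : b ≠ i) :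
    (T.substitute i S f).Edge (outer i S a) (outer i S b) := by
  unfold Edge at h ⊢
  by_cases ha : a = i
  · subst ha
    simp only [outer, dif_pos, substitute, S.parent_root, h, Option.map_some]
  · simp [outer, ha, substitute, h, hb]

theorem Edge.of_substitute_inr {s t : W}
    (h : (T.substitute i S f).Edge (Sum.inr s) (Sum.inr t)) : S.Edge s t := by
  have hs : s ≠ S.root := by
    rintro rfl
    simp only [Edge, substitute, S.parent_root, Option.map_eq_some_iff] at h
    obtain ⟨b, hb, hbt⟩ := h
    have hbi : b = i := by
      by_contra hbi
      simp [outer, hbi] at hbt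
    exact Edge.ne hb hbi.symm
  obtain ⟨t', ht'⟩ := S.exists_edge hs
  obtain rfl : t = t' := Sum.inr_injective (h.unique ht'.substitute_inr)
  exact ht'

theorem blockContr_outer (e : {a : V // a ≠ i} ⊕ W ≃ U) (a : V) :
    blockContr e (e (outer i S a)) = a := by
  by_cases ha : a = i <;> simp [blockContr, outer, ha]

theorem outer_blockContr {e : {a : V // a ≠ i} ⊕ W ≃ U} {u : U} (hu : blockContr e u ≠ i) :
    e (outer i S (blockContr e u)) = u :=
  (eq_of_blockContr_eq (blockContr_outer e _).symm hu).symm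

theorem isComp_relabel_substitute (T : LabelledTree V) (S : LabelledTree W) (f : T.In i → W)
    (e : {a : V // a ≠ i} ⊕ W ≃ U) : T.IsComp e S ((T.substitute i S f).relabel e) := by
  have hS : IsRestriction (blockIncl e) ((T.substitute i S f).relabel e) S := fun s t =>
    ⟨fun h => edge_relabel_iff.2 h.substitute_inr,
      fun h => Edge.of_substitute_inr (edge_relabel_iff.1 h)⟩
  refine hS.isComp_of_edge_imp fun a b hab => ?_
  by_cases hb : b = i
  · subst hb
    exact ⟨_, _, edge_relabel_iff.2 (edge_substitute_of_in ⟨a, hab⟩), blockContr_outer e a,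
      blockContr_blockIncl e _⟩
  · exact ⟨_, _, edge_relabel_iff.2 (hab.substitute_outer hb), blockContr_outer e a,
      blockContr_outer e b⟩

theorem relabel_substitute_injective (T : LabelledTree V) (S : LabelledTree W)
    (e : {a : V // a ≠ i} ⊕ W ≃ U) :
    Function.Injective fun f : T.In i → W => (T.substitute i S f).relabel e := by
  intro f g hfg
  ext j
  have hf := edge_relabel_iff (e := e).2 (edge_substitute_of_in (S := S) (f := f) j)
  have hg := edge_relabel_iff (e := e).2 (edge_substitute_of_in (S := S) (f := g) j)
  dsimp only at hfg
  exact Sum.inr_injective (e.injective (hf.unique (hfg ▸ hg)))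

variable {e : {a : V // a ≠ i} ⊕ W ≃ U} {X : LabelledTree U}

theorem IsComp.exists_edge_blockIncl (h : T.IsComp e S X) (j : T.In i) :
    ∃ w, X.Edge (e (outer i S j)) (blockIncl e w) := by
  obtain ⟨hne, x, y, hxy, hx, hy⟩ := (h.contraction j i).1 j.2
  obtain ⟨w, rfl⟩ := blockContr_eq_iff.1 hy
  exact ⟨w, by rwa [← hx, outer_blockContr (hx ▸ hne)]⟩

theorem IsComp.eq_outer (h : T.IsComp e S X) {x y : U} (hxy : X.Edge x y)
    (hy : blockContr e y ≠ i) : x = e (outer i S (blockContr e x)) := by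
  by_cases hx : blockContr e x = i
  · obtain ⟨s, rfl⟩ := blockContr_eq_iff.1 hx
    have hs : s = S.root := h.restriction.eq_root_of_isTop
      (hxy.isTop ⟨s, rfl⟩ (mt blockContr_eq_iff.2 hy))
    rw [blockContr_blockIncl, outer, dif_pos rfl, hs, blockIncl]
  · exact (outer_blockContr hx).symm

theorem IsComp.exists_eq_substitute (h : T.IsComp e S X) :
    ∃ f, X = (T.substitute i S f).relabel e := by
  choose f hf using h.exists_edge_blockIncl
  refine ⟨f, ext_of_edge_imp fun x y hxy => ?_⟩
  by_cases hy : blockContr e y = i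
  · obtain ⟨t, rfl⟩ := blockContr_eq_iff.1 hy
    by_cases hx : blockContr e x = i
    · obtain ⟨s, rfl⟩ := blockContr_eq_iff.1 hx
      exact edge_relabel_iff.2 ((h.restriction s t).2 hxy).substitute_inr
    · have hj : T.Edge (blockContr e x) i := by
        simpa only [hy] using h.contraction.edge hxy (hy.symm ▸ hx)
      have hft : X.Edge x (blockIncl e (f ⟨_, hj⟩)) := by
        simpa only [outer_blockContr hx] using hf ⟨_, hj⟩
      have hedge := edge_relabel_iff (e := e).2 (edge_substitute_of_in (S := S) (f := f) ⟨_, hj⟩)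
      rw [outer_blockContr hx] at hedge
      exact hxy.unique hft ▸ hedge
  · have hT : T.Edge (blockContr e x) (blockContr e y) := by
      refine h.contraction.edge hxy fun heq => hxy.ne ?_
      exact eq_of_blockContr_eq heq (heq ▸ hy)
    have hedge := edge_relabel_iff (e := e).2 (hT.substitute_outer (S := S) (f := f) hy)
    rwa [outer_blockContr hy, ← h.eq_outer hxy hy] at hedge

end Substitution

section CompAlong

variable {n m p : ℕ} {h : n + m = p + 1} {T : LabelledTree (Fin n)} {i : Fin n}
  {S : LabelledTree (Fin m)} {X : LabelledTree (Fin p)}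

theorem isComp_compAlong (f : T.In i → Fin m) :
    T.IsComp (blockEquiv h i) S (T.compAlong h i S f) :=
  isComp_relabel_substitute T S f _

theorem compAlong_injective (h : n + m = p + 1) (T : LabelledTree (Fin n)) (i : Fin n)
    (S : LabelledTree (Fin m)) : Function.Injective (T.compAlong h i S) :=
  relabel_substitute_injective T S _

theorem IsComp.exists_eq_compAlong (hX : T.IsComp (blockEquiv h i) S X) :
    ∃ f, X = T.compAlong h i S f :=
  hX.exists_eq_substitute

end CompAlong

end LabelledTree

/-! ### The order on trees and the compositions of `T_Max` -/

namespace LabelledTree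

section Order

variable {V : Type*} [LinearOrder V]

/-- `X ≤ Y` if each edge of `X` is obtained by moving the target of an edge of `Y` towards its
source. Among the compositions of two trees, the one along `fMax` is the largest. -/
instance : PartialOrder (LabelledTree V) where
  le X Y := ∀ x y, X.Edge x y → ∃ z, Y.Edge x z ∧ y ∈ Set.uIcc x z
  le_refl _ _ y hxy := ⟨y, hxy, Set.right_mem_uIcc⟩
  le_trans X Y Z hXY hYZ x y hxy := by
    obtain ⟨z, hxz, hyz⟩ := hXY x y hxy
    obtain ⟨w, hxw, hzw⟩ := hYZ x z hxz
    exact ⟨w, hxw, Set.uIcc_subset_uIcc_left hzw hyz⟩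
  le_antisymm X Y hXY hYX := by
    refine ext_of_edge_imp fun x y hxy => ?_
    obtain ⟨z, hxz, hyz⟩ := hXY x y hxy
    obtain ⟨y', hxy', hzy⟩ := hYX x z hxz
    obtain rfl := hxy.unique hxy'
    exact Set.eq_of_mem_uIcc_of_mem_uIcc' hyz hzy ▸ hxz

theorem root_eq_of_le {X Y : LabelledTree V} (h : X ≤ Y) : X.root = Y.root := by
  by_contra hne
  obtain ⟨y, hy⟩ := X.exists_edge (Ne.symm hne)
  obtain ⟨z, hz, -⟩ := h _ _ hy
  exact Y.not_edge_root z hz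

/-- Every edge of `X` entering the set `B` ends at the point of `B` farthest from its source, and
starts on one side of `B`. -/
def IsFarGrafted (X : LabelledTree V) (B : Set V) : Prop :=
  ∀ x y, X.Edge x y → x ∉ B → y ∈ B → B ⊆ Set.uIcc x y

section Functoriality

variable {W : Type*} [LinearOrder W]

theorem IsFarGrafted.of_contraction {π : V → W} {X : LabelledTree V} {T : LabelledTree W}
    {B : Set W} (hB : X.IsFarGrafted (π ⁻¹' B)) (hT : IsContraction π X T) (hπ : Monotone π)
    (hsurj : Function.Surjective π) : T.IsFarGrafted B := by
  intro a b hab ha hb c hc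
  obtain ⟨-, x, y, hxy, rfl, rfl⟩ := (hT a b).1 hab
  obtain ⟨z, rfl⟩ := hsurj c
  exact hπ.mapsTo_uIcc (hB x y hxy ha hb hc)

theorem IsFarGrafted.of_restriction {ι : W → V} {X : LabelledTree V} {S : LabelledTree W}
    {B : Set W} (hB : X.IsFarGrafted (ι '' B)) (hS : IsRestriction ι X S) (hι : StrictMono ι) :
    S.IsFarGrafted B := by
  intro s t hst hs ht b hb
  have hmem : ι b ∈ Set.uIcc (ι s) (ι t) := hB _ _ ((hS s t).1 hst)
    (mt (hι.injective.mem_set_image).1 hs) ⟨t, ht, rfl⟩ ⟨b, hb, rfl⟩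
  simpa only [Set.mem_uIcc, hι.le_iff_le] using hmem

end Functoriality

section Overlap

variable {X : LabelledTree V} {B C : Set V}

theorem IsFarGrafted.notMem_of_isTop (hB : X.IsFarGrafted B) (hC : X.IsConnected C)
    (hCB : (C \ B).Nonempty) (hfar : ∀ x ∈ C \ B, ∀ y ∈ B ∩ C, ¬ B ⊆ Set.uIcc x y) {t : V}
    (ht : X.IsTop C t) : t ∉ B := by
  intro htB
  obtain ⟨z, hz⟩ := X.exists_isTop hCB
  have hzC : ¬ X.IsTop C z := fun h => hz.1.2 (hC h ht ▸ htB)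
  obtain ⟨w, hzw, hwC⟩ : ∃ w, X.Edge z w ∧ w ∈ C := by
    simpa [IsTop, hz.1.1] using hzC
  have hwB : w ∈ B := by
    by_contra hwB
    exact hz.2 w hzw ⟨hwC, hwB⟩
  exact hfar z hz.1 w ⟨hwB, hwC⟩ (hB z w hzw hz.1.2 hwB)

theorem IsFarGrafted.disjoint (hB : X.IsFarGrafted B) (hC : X.IsFarGrafted C)
    (hB' : X.IsConnected B) (hC' : X.IsConnected C)
    (hBC : (B \ C).Nonempty) (hCB : (C \ B).Nonempty)
    (hfarB : ∀ x ∈ C \ B, ∀ y ∈ B ∩ C, ¬ B ⊆ Set.uIcc x y)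
    (hfarC : ∀ x ∈ B \ C, ∀ y ∈ C ∩ B, ¬ C ⊆ Set.uIcc x y) : Disjoint B C := by
  rw [Set.disjoint_iff_inter_eq_empty, ← Set.not_nonempty_iff_eq_empty]
  intro hne
  obtain ⟨z, ⟨hzB, hzC⟩, hz⟩ := X.exists_isTop hne
  have hzB' : ¬ X.IsTop B z := fun h => hC.notMem_of_isTop hB' hBC hfarC h hzC
  have hzC' : ¬ X.IsTop C z := fun h => hB.notMem_of_isTop hC' hCB hfarB h hzB
  obtain ⟨u, hzu, huB⟩ : ∃ u, X.Edge z u ∧ u ∈ B := by simpa [IsTop, hzB] using hzB'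
  obtain ⟨v, hzv, hvC⟩ : ∃ v, X.Edge z v ∧ v ∈ C := by simpa [IsTop, hzC] using hzC'
  exact hz u hzu ⟨huB, hzu.unique hzv ▸ hvC⟩

end Overlap

section MaxComp

variable {U : Type*} {W : Type*} [LinearOrder U] {i : V} {e : {a : V // a ≠ i} ⊕ W ≃ U}
  {T T' : LabelledTree V} {S S' : LabelledTree W} {X X' : LabelledTree U}

theorem mem_uIcc_of_blockContr_mem_uIcc (hcontr : Monotone (blockContr e)) {x y z : U}
    (hne : blockContr e x ≠ blockContr e y)
    (hy : blockContr e y ∈ Set.uIcc (blockContr e x) (blockContr e z))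
    (hblock : blockContr e y = i → blockContr e z = i → y ∈ Set.uIcc x z) : y ∈ Set.uIcc x z := by
  by_cases hyz : blockContr e y = blockContr e z
  · by_cases hyi : blockContr e y = i
    · exact hblock hyi (hyz ▸ hyi)
    · exact eq_of_blockContr_eq hyz hyi ▸ Set.right_mem_uIcc
  · rw [Set.mem_uIcc] at hy ⊢
    exact hy.imp
      (fun h => ⟨(hcontr.reflect_lt (h.1.lt_of_ne hne)).le,
        (hcontr.reflect_lt (h.2.lt_of_ne hyz)).le⟩)
      (fun h => ⟨(hcontr.reflect_lt (h.1.lt_of_ne (Ne.symm hyz))).le,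
        (hcontr.reflect_lt (h.2.lt_of_ne (Ne.symm hne))).le⟩)

/-- `X` is the composition of `T` and `S` along the analogue of `fMax`. -/
structure IsMaxComp (e : {a : V // a ≠ i} ⊕ W ≃ U) (T : LabelledTree V) (S : LabelledTree W)
    (X : LabelledTree U) : Prop extends IsComp e T S X where
  isFarGrafted : X.IsFarGrafted (Set.range (blockIncl e))

theorem IsMaxComp.le [LinearOrder W] (h : T.IsMaxComp e S X) (h' : T'.IsComp e S' X')
    (hcontr : Monotone (blockContr e)) (hincl : Monotone (blockIncl e)) (hT : T' ≤ T)
    (hS : S' ≤ S) : X' ≤ X := by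
  intro x y hxy
  by_cases heq : blockContr e x = blockContr e y
  · have hx : blockContr e x = i := by
      by_contra hx
      exact hxy.ne (eq_of_blockContr_eq heq hx)
    obtain ⟨s, rfl⟩ := blockContr_eq_iff.1 hx
    obtain ⟨t, rfl⟩ := blockContr_eq_iff.1 (heq.symm.trans hx)
    obtain ⟨z, hsz, htz⟩ := hS s t ((h'.restriction s t).2 hxy)
    exact ⟨_, (h.restriction s z).1 hsz, hincl.mapsTo_uIcc htz⟩
  · obtain ⟨c, hc, hyc⟩ := hT _ _ (h'.contraction.edge hxy heq)
    obtain ⟨z, hxz, rfl⟩ := h.exists_edge_of_ne h' (root_eq_of_le hS) hxy heq hc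
    refine ⟨z, hxz, mem_uIcc_of_blockContr_mem_uIcc hcontr heq hyc fun hy hz => ?_⟩
    exact h.isFarGrafted x z hxz (mt blockContr_eq_iff.2 fun hx => heq (hx.trans hy.symm))
      (blockContr_eq_iff.1 hz) (blockContr_eq_iff.1 hy)

end MaxComp

end Order

section CommonRefinement

variable {U : Type*} {V : Type*} {W : Type*} {W' : Type*} {Y : Type*} {Y' : Type*} {Z : Type*}
  {A : LabelledTree V} {B : LabelledTree W} {C : LabelledTree W'} {X : LabelledTree U}
  {AB : LabelledTree Y} {AC : LabelledTree Y'} {BC : LabelledTree Z}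
  [LinearOrder U] [LinearOrder Y]

theorem IsNested.exists_isMaxComp [LinearOrder Z] {i : V} {j : W} {y : Y}
    {e₁ : {a : V // a ≠ i} ⊕ Z ≃ U} {e₂ : {a : Y // a ≠ y} ⊕ W' ≃ U}
    {e₃ : {a : W // a ≠ j} ⊕ W' ≃ Z} {e₄ : {a : V // a ≠ i} ⊕ W ≃ Y}
    (he : IsNested e₁ e₂ e₃ e₄) (hincl : StrictMono (blockIncl e₁))
    (hcontr : Monotone (blockContr e₂)) (h : A.IsMaxComp e₁ BC X) (h' : AB.IsMaxComp e₂ C X) :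
    ∃ B : LabelledTree W, B.IsMaxComp e₃ C BC ∧ A.IsMaxComp e₄ B AB := by
  have hC : IsRestriction (blockIncl e₃) BC C :=
    h.restriction.comp_iff.2 (he.incl_incl ▸ h'.restriction)
  obtain ⟨B, hB⟩ := hC.exists_isComp
  have : Nonempty W' := ⟨C.root⟩
  refine ⟨B, ⟨hB, ?_⟩, ⟨he.isComp_outer hB h.toIsComp h'.toIsComp, ?_⟩⟩
  · refine .of_restriction ?_ h.restriction hincl
    rw [← Set.range_comp, he.incl_incl]
    exact h'.isFarGrafted
  · exact .of_contraction (he.preimage_range ▸ h.isFarGrafted) h'.contraction hcontr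
      blockContr_surjective

theorem IsDisjoint.exists_isMaxComp [LinearOrder Y'] {i j : V} {y : Y} {y' : Y'}
    {e₁ : {a : V // a ≠ i} ⊕ W ≃ Y} {e₂ : {a : Y // a ≠ y} ⊕ W' ≃ U}
    {e₃ : {a : V // a ≠ j} ⊕ W' ≃ Y'} {e₄ : {a : Y' // a ≠ y'} ⊕ W ≃ U}
    (he : IsDisjoint e₁ e₂ e₃ e₄) (hcontr : Monotone (blockContr e₂))
    (hcontr' : Monotone (blockContr e₄)) (h : AB.IsMaxComp e₂ C X) (h' : AC.IsMaxComp e₄ B X) :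
    ∃ A : LabelledTree V, A.IsMaxComp e₁ B AB ∧ A.IsMaxComp e₃ C AC := by
  have : Nonempty W := ⟨B.root⟩
  have : Nonempty W' := ⟨C.root⟩
  have hB : IsRestriction (blockIncl e₁) AB B :=
    (h.contraction.base_change (blockIncl_injective e₁) he.contr_incl he.preimage_range.le
      h'.restriction).1 isContraction_id
  obtain ⟨A, hA⟩ := hB.exists_isComp
  refine ⟨A, ⟨hA, ?_⟩, ⟨he.isComp hA h.toIsComp h'.toIsComp, ?_⟩⟩
  · exact .of_contraction (he.preimage_range ▸ h'.isFarGrafted) h.contraction hcontr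
      blockContr_surjective
  · exact .of_contraction (he.symm.preimage_range ▸ h.isFarGrafted) h'.contraction hcontr'
      blockContr_surjective

end CommonRefinement

section BlockEquiv

variable {n m l p q r : ℕ}

theorem val_blockContr_blockEquiv (h : n + m = p + 1) (i : Fin n) (x : Fin p) :
    (blockContr (blockEquiv h i) x).val =
      if (x : ℕ) < i then (x : ℕ) else if (x : ℕ) < i + m then (i : ℕ) else x + 1 - m := by
  by_cases h₁ : (x : ℕ) < i
  · simp [blockContr, blockEquiv, h₁]
  · by_cases h₂ : (x : ℕ) < i + m <;> simp [blockContr, blockEquiv, h₁, h₂]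

theorem val_blockIncl_blockEquiv (h : n + m = p + 1) (i : Fin n) (s : Fin m) :
    (blockIncl (blockEquiv h i) s).val = i + s :=
  rfl

theorem mem_range_blockIncl_blockEquiv {h : n + m = p + 1} {i : Fin n} {x : Fin p} :
    x ∈ Set.range (blockIncl (blockEquiv h i)) ↔ (i : ℕ) ≤ x ∧ (x : ℕ) < i + m := by
  constructor
  · rintro ⟨s, rfl⟩
    rw [val_blockIncl_blockEquiv]
    omega
  · rintro ⟨h₁, h₂⟩
    refine ⟨⟨x - i, by omega⟩, Fin.ext ?_⟩
    rw [val_blockIncl_blockEquiv]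
    dsimp only
    omega

theorem monotone_blockContr_blockEquiv (h : n + m = p + 1) (i : Fin n) :
    Monotone (blockContr (blockEquiv h i)) := by
  intro x y hxy
  rw [Fin.le_def] at hxy ⊢
  simp only [val_blockContr_blockEquiv]
  split_ifs <;> omega

theorem strictMono_blockIncl_blockEquiv (h : n + m = p + 1) (i : Fin n) :
    StrictMono (blockIncl (blockEquiv h i)) := by
  intro s t hst
  rw [Fin.lt_def] at hst ⊢
  simpa only [val_blockIncl_blockEquiv, Nat.add_lt_add_iff_left] using hst

theorem isNested_blockEquiv (hp : n + m = p + 1) (hr : p + l = r + 1) (hq : m + l = q + 1)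
    (hr' : n + q = r + 1) {i : Fin n} {j : Fin m} {i' : Fin p} (hi' : (i' : ℕ) = i + j) :
    IsNested (blockEquiv hr' i) (blockEquiv hr i') (blockEquiv hq j)
      (blockEquiv hp i) where
  contr_contr := by
    ext x
    simp only [Function.comp_apply, val_blockContr_blockEquiv]
    grind
  incl_incl := by
    ext s
    simp only [Function.comp_apply, val_blockIncl_blockEquiv]
    omega
  contr_incl := by
    ext x
    simp only [Function.comp_apply, val_blockContr_blockEquiv, val_blockIncl_blockEquiv]
    grind

theorem isDisjoint_blockEquiv (hp : n + m = p + 1) (hr : p + l = r + 1) (hq : n + l = q + 1)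
    (hr' : q + m = r + 1) {i j : Fin n} {j' : Fin p} {i' : Fin q} (hji : (j : ℕ) < i)
    (hj' : (j' : ℕ) = j) (hi' : (i' : ℕ) + 1 = i + l) :
    IsDisjoint (blockEquiv hp i) (blockEquiv hr j') (blockEquiv hq j) (blockEquiv hr' i') where
  ne := by
    rintro rfl
    omega
  contr_contr := by
    ext x
    simp only [Function.comp_apply, val_blockContr_blockEquiv]
    grind
  contr_incl := by
    ext s
    simp only [Function.comp_apply, val_blockContr_blockEquiv, val_blockIncl_blockEquiv]
    grind
  contr_incl' := by
    ext s
    simp only [Function.comp_apply, val_blockContr_blockEquiv, val_blockIncl_blockEquiv]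
    grind

end BlockEquiv

section MaxComp

variable {n m n' m' p : ℕ} {h : n + m = p + 1} {h' : n' + m' = p + 1} {i : Fin n} {i' : Fin n'}
  {T : LabelledTree (Fin n)} {S : LabelledTree (Fin m)} {X : LabelledTree (Fin p)}
  {T' : LabelledTree (Fin n')} {S' : LabelledTree (Fin m')}

theorem isMaxComp_maxComp (h : n + m = p + 1) (T : LabelledTree (Fin n)) (i : Fin n)
    (S : LabelledTree (Fin m)) : T.IsMaxComp (blockEquiv h i) S (T.maxComp h i S) := by
  refine ⟨isComp_compAlong _, fun x y hxy hx hy z hz => ?_⟩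
  have hx' : blockContr (blockEquiv h i) x ≠ i := mt blockContr_eq_iff.1 hx
  have hj : T.Edge (blockContr (blockEquiv h i) x) i := by
    have hxy' := (isComp_compAlong (T.fMax i S)).contraction.edge hxy
    rw [blockContr_eq_iff.2 hy] at hxy'
    exact hxy' hx'
  have hedge : (T.maxComp h i S).Edge (blockEquiv h i (outer i S (blockContr (blockEquiv h i) x)))
      (blockIncl (blockEquiv h i) (T.fMax i S ⟨_, hj⟩)) :=
    edge_relabel_iff.2 (edge_substitute_of_in ⟨_, hj⟩)
  rw [outer_blockContr hx'] at hedge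
  rw [hxy.unique hedge, Set.mem_uIcc, Fin.le_def, Fin.le_def, Fin.le_def, Fin.le_def,
    val_blockIncl_blockEquiv]
  rw [mem_range_blockIncl_blockEquiv] at hx hz
  have hval := val_blockContr_blockEquiv h i x
  unfold fMax
  split_ifs at hval ⊢ with h₁ <;> rw [Fin.lt_def] at h₁ <;> dsimp only at h₁ ⊢ <;> omega

theorem isMaxComp_iff : T.IsMaxComp (blockEquiv h i) S X ↔ X = T.maxComp h i S := by
  refine ⟨fun hX => ?_, fun hX => hX ▸ isMaxComp_maxComp h T i S⟩
  have hcontr := monotone_blockContr_blockEquiv h i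
  have hincl := (strictMono_blockIncl_blockEquiv h i).monotone
  have hmax := isMaxComp_maxComp h T i S
  exact le_antisymm (hmax.le hX.toIsComp hcontr hincl le_rfl le_rfl)
    (hX.le hmax.toIsComp hcontr hincl le_rfl le_rfl)

theorem IsMaxComp.add_le (hX : T.IsMaxComp (blockEquiv h i) S X)
    (hX' : T'.IsMaxComp (blockEquiv h' i') S' X) (hlt : (i : ℕ) < i') (hlt' : i + m < i' + m') :
    i + m ≤ (i' : ℕ) := by
  by_contra! hover
  have hdisj := hX.isFarGrafted.disjoint hX'.isFarGrafted hX.restriction.isConnected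
    hX'.restriction.isConnected ⟨⟨i, by omega⟩, ?_⟩ ⟨⟨i + m, by omega⟩, ?_⟩ ?_ ?_
  · rw [Set.disjoint_left] at hdisj
    have hnotMem := @hdisj ⟨i', by omega⟩
    simp only [mem_range_blockIncl_blockEquiv] at hnotMem
    omega
  · simp only [Set.mem_sdiff, mem_range_blockIncl_blockEquiv]
    omega
  · simp only [Set.mem_sdiff, mem_range_blockIncl_blockEquiv]
    omega
  · intro x hx y hy hsub
    have hfirst := @hsub ⟨i, by omega⟩
    simp only [Set.mem_sdiff, Set.mem_inter_iff, mem_range_blockIncl_blockEquiv, Set.mem_uIcc,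
      Fin.le_def] at hx hy hfirst
    omega
  · intro x hx y hy hsub
    have hlast := @hsub ⟨i' + m' - 1, by omega⟩
    simp only [Set.mem_sdiff, Set.mem_inter_iff, mem_range_blockIncl_blockEquiv, Set.mem_uIcc,
      Fin.le_def] at hx hy hlast
    omega

theorem IsMaxComp.nested_or_disjoint (hX : T.IsMaxComp (blockEquiv h i) S X)
    (hX' : T'.IsMaxComp (blockEquiv h' i') S' X) :
    ((i : ℕ) ≤ i' ∧ (i' + m' : ℕ) ≤ i + m) ∨ ((i' : ℕ) ≤ i ∧ (i + m : ℕ) ≤ i' + m') ∨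
      (i + m : ℕ) ≤ i' ∨ (i' + m' : ℕ) ≤ i := by
  have h₁ := hX.add_le hX'
  have h₂ := hX'.add_le hX
  omega

end MaxComp

end LabelledTree

/-! ### The pre-Lie operad -/

namespace LabelledTree

section Finite

variable {V : Type*}

instance [Finite V] : Finite (LabelledTree V) :=
  Finite.of_injective LabelledTree.parent fun _ _ h =>
    ext_of_edge_imp fun a _ hab => (congrFun h a).symm.trans hab

instance [IsEmpty V] : IsEmpty (LabelledTree V) :=
  ⟨fun X => isEmptyElim X.root⟩

instance [Unique V] : Unique (LabelledTree V) where
  default := ⟨fun _ => none, default, rfl, fun x => by rw [Subsingleton.elim x default]⟩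
  uniq _ := ext_of_edge_imp fun a b hab => absurd (Subsingleton.elim a b) hab.ne

end Finite

section Sums

open Finset

variable {U : Type*} {V : Type*} {W : Type*} {W' : Type*} {Y : Type*} {Y' : Type*} {Z : Type*}
  [Finite U]

/-- The trees occurring in the pre-Lie composition of `T` and `S` at the vertex `i`. -/
noncomputable def compSet {i : V} (e : {a : V // a ≠ i} ⊕ W ≃ U) (T : LabelledTree V)
    (S : LabelledTree W) : Finset (LabelledTree U) :=
  {X | T.IsComp e S X}.toFinite.toFinset

theorem mem_compSet {i : V} {e : {a : V // a ≠ i} ⊕ W ≃ U} {T : LabelledTree V}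
    {S : LabelledTree W} {X : LabelledTree U} : X ∈ T.compSet e S ↔ T.IsComp e S X := by
  simp [compSet]

theorem pairwiseDisjoint_compSet_left {i : V} (e : {a : V // a ≠ i} ⊕ W ≃ U)
    (s : Set (LabelledTree V)) (S : LabelledTree W) : s.PairwiseDisjoint fun T => T.compSet e S :=
  fun _ _ _ _ hne => disjoint_left.2 fun _ h h' =>
    hne ((mem_compSet.1 h).unique (mem_compSet.1 h')).1

theorem pairwiseDisjoint_compSet_right {i : V} (e : {a : V // a ≠ i} ⊕ W ≃ U)
    (T : LabelledTree V) (s : Set (LabelledTree W)) : s.PairwiseDisjoint (T.compSet e) :=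
  fun _ _ _ _ hne => disjoint_left.2 fun _ h h' =>
    hne ((mem_compSet.1 h).unique (mem_compSet.1 h')).2

variable {M : Type*} [AddCommMonoid M] (F : LabelledTree U → M)

open Classical in
theorem IsNested.sum_compSet [Finite Y] [Finite Z] {i : V} {j : W} {y : Y}
    {e₁ : {a : V // a ≠ i} ⊕ Z ≃ U} {e₂ : {a : Y // a ≠ y} ⊕ W' ≃ U}
    {e₃ : {a : W // a ≠ j} ⊕ W' ≃ Z} {e₄ : {a : V // a ≠ i} ⊕ W ≃ Y}
    (he : IsNested e₁ e₂ e₃ e₄) (A : LabelledTree V) (B : LabelledTree W) (C : LabelledTree W') :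
    ∑ AB ∈ A.compSet e₄ B, ∑ X ∈ AB.compSet e₂ C, F X =
      ∑ BC ∈ B.compSet e₃ C, ∑ X ∈ A.compSet e₁ BC, F X := by
  rw [← sum_biUnion (pairwiseDisjoint_compSet_left e₂ _ C),
    ← sum_biUnion (pairwiseDisjoint_compSet_right e₁ A _)]
  congr 1
  ext X
  simp only [mem_biUnion, mem_compSet]
  constructor
  · rintro ⟨AB, hAB, hX⟩
    exact he.exists_isComp_inner hAB hX
  · rintro ⟨BC, hBC, hX⟩
    exact he.exists_isComp_outer hBC hX

open Classical in
theorem IsDisjoint.sum_compSet [Finite Y] [Finite Y'] {i j : V} {y : Y} {y' : Y'}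
    {e₁ : {a : V // a ≠ i} ⊕ W ≃ Y} {e₂ : {a : Y // a ≠ y} ⊕ W' ≃ U}
    {e₃ : {a : V // a ≠ j} ⊕ W' ≃ Y'} {e₄ : {a : Y' // a ≠ y'} ⊕ W ≃ U}
    (he : IsDisjoint e₁ e₂ e₃ e₄) (A : LabelledTree V) (B : LabelledTree W)
    (C : LabelledTree W') :
    ∑ AB ∈ A.compSet e₁ B, ∑ X ∈ AB.compSet e₂ C, F X =
      ∑ AC ∈ A.compSet e₃ C, ∑ X ∈ AC.compSet e₄ B, F X := by
  rw [← sum_biUnion (pairwiseDisjoint_compSet_left e₂ _ C),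
    ← sum_biUnion (pairwiseDisjoint_compSet_left e₄ _ B)]
  congr 1
  ext X
  simp only [mem_biUnion, mem_compSet]
  constructor
  · rintro ⟨AB, hAB, hX⟩
    exact he.exists_isComp hAB hX
  · rintro ⟨AC, hAC, hX⟩
    exact he.symm.exists_isComp hAC hX

end Sums

theorem sum_compAlong {n m p : ℕ} {M : Type*} [AddCommMonoid M] (h : n + m = p + 1)
    (T : LabelledTree (Fin n)) (i : Fin n) (S : LabelledTree (Fin m))
    (F : LabelledTree (Fin p) → M) :
    ∑ f : T.In i → Fin m, F (T.compAlong h i S f) = ∑ X ∈ T.compSet (blockEquiv h i) S, F X := by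
  refine Finset.sum_bij (fun f _ => T.compAlong h i S f) ?_ ?_ ?_ ?_
  · exact fun f _ => mem_compSet.2 (isComp_compAlong f)
  · exact fun f _ g _ hfg => compAlong_injective h T i S hfg
  · intro X hX
    obtain ⟨f, rfl⟩ := (mem_compSet.1 hX).exists_eq_compAlong
    exact ⟨f, Finset.mem_univ _, rfl⟩
  · exact fun _ _ => rfl

theorem compSet_one_left {n : ℕ} (h : 1 + n = n + 1) (T : LabelledTree (Fin 1))
    (S : LabelledTree (Fin n)) : T.compSet (blockEquiv h 0) S = {S} := by
  have hid : blockIncl (blockEquiv h 0) = id := by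
    ext s
    simp [val_blockIncl_blockEquiv]
  ext X
  rw [mem_compSet, Finset.mem_singleton, isComp_iff_of_blockIncl_eq_id hid]

theorem compSet_one_right {n : ℕ} (h : n + 1 = n + 1) (T : LabelledTree (Fin n)) (i : Fin n)
    (S : LabelledTree (Fin 1)) : T.compSet (blockEquiv h i) S = {T} := by
  have hid : blockContr (blockEquiv h i) = id := by
    ext x
    rw [val_blockContr_blockEquiv]
    grind
  ext X
  rw [mem_compSet, Finset.mem_singleton, isComp_iff_of_blockContr_eq_id hid]

end LabelledTree

namespace preLie

open LabelledTree

variable {k : Type u} [Field k] {n m p : ℕ}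

variable (k) in
/-- A tree as an element of the pre-Lie operad. -/
noncomputable def of (T : LabelledTree (Fin n)) : (preLie k).obj n :=
  (Finsupp.single T 1 : LabelledTree (Fin n) →₀ k)

/-- The linear map on the pre-Lie operad with prescribed values on the trees. -/
noncomputable def lift {M : Type*} [AddCommGroup M] [Module k M] (F : LabelledTree (Fin n) → M) :
    (preLie k).obj n →ₗ[k] M :=
  Finsupp.linearCombination k F

theorem lift_of {M : Type*} [AddCommGroup M] [Module k M] (F : LabelledTree (Fin n) → M)
    (T : LabelledTree (Fin n)) : lift F (of k T) = F T :=
  (Finsupp.linearCombination_single k 1 T).trans (one_smul k _)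

theorem hom_ext {M : Type*} [AddCommGroup M] [Module k M] {F G : (preLie k).obj n →ₗ[k] M}
    (h : ∀ T, F (of k T) = G (of k T)) : F = G :=
  Finsupp.lhom_ext' fun T => LinearMap.ext_ring (h T)

theorem one_eq : (preLie k).one = of k default :=
  congrArg (of k) (Subsingleton.elim _ _)

theorem comp_of (h : n + m = p + 1) (i : Fin n) (T : LabelledTree (Fin n))
    (S : LabelledTree (Fin m)) :
    (preLie k).comp h i (of k T) (of k S) = ∑ X ∈ T.compSet (blockEquiv h i) S, of k X := by
  have hT : (preLie k).comp h i (of k T) =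
      lift fun S => ∑ f : T.In i → Fin m, of k (T.compAlong h i S f) := lift_of (k := k) _ T
  rw [hT, lift_of, sum_compAlong]

theorem isOperad : (preLie k).IsOperad where
  assoc hp hr hq hr' i j a b c := by
    have hABC A B : (preLie k).comp hr ⟨i + j, by omega⟩ ((preLie k).comp hp i (of k A) (of k B)) =
        (preLie k).comp hr' i (of k A) ∘ₗ (preLie k).comp hq j (of k B) := by
      refine hom_ext fun C => ?_
      simp only [LinearMap.comp_apply, comp_of, map_sum, LinearMap.sum_apply]
      exact (isNested_blockEquiv hp hr hq hr' rfl).sum_compSet (of k) A B C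
    have hAB A : ((preLie k).comp hr ⟨i + j, by omega⟩).flip c ∘ₗ (preLie k).comp hp i (of k A) =
        (preLie k).comp hr' i (of k A) ∘ₗ ((preLie k).comp hq j).flip c :=
      hom_ext fun B => LinearMap.congr_fun (hABC A B) c
    have hA : ((preLie k).comp hr ⟨i + j, by omega⟩).flip c ∘ₗ ((preLie k).comp hp i).flip b =
        ((preLie k).comp hr' i).flip ((preLie k).comp hq j b c) :=
      hom_ext fun A => LinearMap.congr_fun (hAB A) b
    exact LinearMap.congr_fun hA a
  comm {n m l p q r} hp hr hq hr' i j hji a b c := by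
    have hABC A B : (preLie k).comp hr ⟨j, by omega⟩ ((preLie k).comp hp i (of k A) (of k B)) =
        ((preLie k).comp hr' ⟨i + l - 1, by omega⟩).flip (of k B) ∘ₗ
          (preLie k).comp hq j (of k A) := by
      refine hom_ext fun C => ?_
      simp only [LinearMap.comp_apply, LinearMap.flip_apply, comp_of, map_sum, LinearMap.sum_apply]
      have he := isDisjoint_blockEquiv hp hr hq hr' (j' := ⟨j, by omega⟩)
        (i' := ⟨i + l - 1, by omega⟩) hji rfl (by dsimp only; omega)
      exact he.sum_compSet (of k) A B C
    have hAB A : ((preLie k).comp hr ⟨j, by omega⟩).flip c ∘ₗ (preLie k).comp hp i (of k A) =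
        (preLie k).comp hr' ⟨i + l - 1, by omega⟩ ((preLie k).comp hq j (of k A) c) :=
      hom_ext fun B => LinearMap.congr_fun (hABC A B) c
    have hA : ((preLie k).comp hr ⟨j, by omega⟩).flip c ∘ₗ ((preLie k).comp hp i).flip b =
        ((preLie k).comp hr' ⟨i + l - 1, by omega⟩).flip b ∘ₗ ((preLie k).comp hq j).flip c :=
      hom_ext fun A => LinearMap.congr_fun (hAB A) b
    exact LinearMap.congr_fun hA a
  one_comp h a := by
    have hS : (preLie k).comp h 0 (preLie k).one = LinearMap.id := hom_ext fun S => by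
      rw [one_eq, comp_of, compSet_one_left, Finset.sum_singleton, LinearMap.id_apply]
    exact LinearMap.congr_fun hS a
  comp_one h i a := by
    have hT : ((preLie k).comp h i).flip (preLie k).one = LinearMap.id := hom_ext fun T => by
      rw [LinearMap.flip_apply, one_eq, comp_of, compSet_one_right, Finset.sum_singleton,
        LinearMap.id_apply]
    exact LinearMap.congr_fun hT a

theorem isReduced : (preLie k).IsReduced where
  zero := inferInstanceAs (Subsingleton (LabelledTree (Fin 0) →₀ k))
  one := by
    let e : (preLie k).obj 1 ≃ₗ[k] k :=
      Finsupp.uniqueLinearEquiv k k (default : LabelledTree (Fin 1))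
    have hsmul (c : k) : c • (preLie k).one = e.symm c := by
      rw [one_eq]
      exact (Finsupp.smul_single c _ 1).trans (by rw [smul_eq_mul, mul_one]; rfl)
    simp only [hsmul]
    exact e.symm.bijective

end preLie

/-! ### Freeness -/

namespace OperadData

variable {k : Type u} [Field k] {P : OperadData.{u, v} k} {Q : OperadData.{u, w} k}
  (φ : ∀ n, P.obj n →ₗ[k] Q.obj n) {n m l p q r : ℕ}

/-- The failure of a family `φ` of linear maps to preserve the partial composition at `i`, as a
bilinear map. -/
noncomputable def compDefect (h : n + m = p + 1) (i : Fin n) :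
    P.obj n →ₗ[k] P.obj m →ₗ[k] Q.obj p :=
  (Q.comp h i).compl₁₂ (φ n) (φ m) - (P.comp h i).compr₂ (φ p)

theorem compDefect_apply (h : n + m = p + 1) (i : Fin n) (a : P.obj n) (b : P.obj m) :
    compDefect φ h i a b = Q.comp h i (φ n a) (φ m b) - φ p (P.comp h i a b) :=
  rfl

variable {φ}

theorem compDefect_assoc (hP : P.IsOperad) (hQ : Q.IsOperad) (hp : n + m = p + 1)
    (hr : p + l = r + 1) (hq : m + l = q + 1) (hr' : n + q = r + 1) {i : Fin n} {j : Fin m}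
    {i' : Fin p} (hi' : (i' : ℕ) = i + j) {a : P.obj n} {b : P.obj m} {c : P.obj l}
    (hab : compDefect φ hp i a b = 0) (hbc : compDefect φ hq j b c = 0) :
    compDefect φ hr i' (P.comp hp i a b) c =
      compDefect φ hr' i a (P.comp hq j b c) := by
  obtain ⟨x, hx⟩ := i'
  obtain rfl : x = i + j := hi'
  rw [compDefect_apply, sub_eq_zero] at hab hbc
  rw [compDefect_apply, compDefect_apply, ← hab, ← hbc, hQ.assoc hp hr hq hr',
    hP.assoc hp hr hq hr']

theorem compDefect_comm (hP : P.IsOperad) (hQ : Q.IsOperad) (hp : n + m = p + 1)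
    (hr : p + l = r + 1) (hq : n + l = q + 1) (hr' : q + m = r + 1) {i j : Fin n}
    {j' : Fin p} {i' : Fin q} (hji : (j : ℕ) < i) (hj' : (j' : ℕ) = j)
    (hi' : (i' : ℕ) + 1 = i + l) {a : P.obj n} {b : P.obj m} {c : P.obj l}
    (hab : compDefect φ hp i a b = 0) (hac : compDefect φ hq j a c = 0) :
    compDefect φ hr j' (P.comp hp i a b) c = compDefect φ hr' i' (P.comp hq j a c) b := by
  obtain ⟨x, hx⟩ := j'
  obtain rfl : x = j := hj'
  obtain ⟨y, hy⟩ := i'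
  obtain rfl : y = i + l - 1 := Nat.eq_sub_of_add_eq hi'
  rw [compDefect_apply, sub_eq_zero] at hab hac
  rw [compDefect_apply, compDefect_apply, ← hab, ← hac, hQ.comm hp hr hq hr' i j hji,
    hP.comm hp hr hq hr' i j hji]

theorem compDefect_one_left (hP : P.IsOperad) (hQ : Q.IsOperad) (hone : φ 1 P.one = Q.one)
    (h : 1 + n = n + 1) (a : P.obj n) : compDefect φ h 0 P.one a = 0 := by
  rw [compDefect_apply, hone, hQ.one_comp, hP.one_comp, sub_self]

theorem compDefect_one_right (hP : P.IsOperad) (hQ : Q.IsOperad) (hone : φ 1 P.one = Q.one)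
    (h : n + 1 = n + 1) (i : Fin n) (a : P.obj n) : compDefect φ h i a P.one = 0 := by
  rw [compDefect_apply, hone, hQ.comp_one, hP.comp_one, sub_self]

end OperadData

namespace LabelledTree

section

variable {n m p : ℕ} {h : n + m = p + 1} {i : Fin n} {T T' : LabelledTree (Fin n)}
  {S S' : LabelledTree (Fin m)} {X Y : LabelledTree (Fin p)}

theorem IsMaxComp.le_of_isComp (hX : T.IsMaxComp (blockEquiv h i) S X)
    (hY : T'.IsComp (blockEquiv h i) S' Y) (hT : T' ≤ T) (hS : S' ≤ S) : Y ≤ X :=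
  hX.le hY (monotone_blockContr_blockEquiv h i) (strictMono_blockIncl_blockEquiv h i).monotone
    hT hS

end

theorem induction_arity_lt {motive : ∀ p, LabelledTree (Fin p) → Prop}
    (step : ∀ p X, (∀ q < p, ∀ Y, motive q Y) → (∀ Y < X, motive p Y) → motive p X) (p : ℕ)
    (X : LabelledTree (Fin p)) : motive p X := by
  induction p using Nat.strong_induction_on with
  | _ p ihp =>
    induction X using WellFoundedLT.induction with
    | _ X ihX => exact step p X ihp ihX

/-- A non-trivial decomposition of a tree in the operad `T_Max`. -/
structure MaxDecomp {p : ℕ} (X : LabelledTree (Fin p)) where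
  n : ℕ
  m : ℕ
  arity : n + m = p + 1
  outer : LabelledTree (Fin n)
  idx : Fin n
  inner : LabelledTree (Fin m)
  one_lt_outer : 1 < n
  one_lt_inner : 1 < m
  isMaxComp : outer.IsMaxComp (blockEquiv arity idx) inner X

section

variable {p : ℕ} {X : LabelledTree (Fin p)}

theorem nonempty_maxDecomp : Nonempty X.MaxDecomp ↔ X.IsDecomposable :=
  ⟨fun ⟨⟨n, m, h, T, i, S, hn, hm, hX⟩⟩ => ⟨n, m, h, T, i, S, hn, hm, isMaxComp_iff.1 hX⟩,
    fun ⟨n, m, h, T, i, S, hn, hm, hX⟩ => ⟨⟨n, m, h, T, i, S, hn, hm, isMaxComp_iff.2 hX⟩⟩⟩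

namespace MaxDecomp

theorem outer_lt (d : X.MaxDecomp) : d.n < p := by
  have := d.arity
  have := d.one_lt_inner
  omega

theorem inner_lt (d : X.MaxDecomp) : d.m < p := by
  have := d.arity
  have := d.one_lt_outer
  omega

open Classical in
/-- The trees other than `X` in the pre-Lie composition of the two factors of `X`. -/
noncomputable def lowerTerms (d : X.MaxDecomp) : Finset (LabelledTree (Fin p)) :=
  (d.outer.compSet (blockEquiv d.arity d.idx) d.inner).erase X

theorem lt_of_mem_lowerTerms (d : X.MaxDecomp) {Y : LabelledTree (Fin p)}
    (hY : Y ∈ d.lowerTerms) : Y < X := by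
  classical
  obtain ⟨hne, hY⟩ := Finset.mem_erase.1 hY
  exact (d.isMaxComp.le_of_isComp (mem_compSet.1 hY) le_rfl le_rfl).lt_of_ne hne

end MaxDecomp

end

end LabelledTree

namespace preLie

open LabelledTree OperadData

variable {k : Type u} [Field k] {n m l p q r : ℕ}

theorem comp_maxDecomp {X : LabelledTree (Fin p)} (d : X.MaxDecomp) :
    (preLie k).comp d.arity d.idx (of k d.outer) (of k d.inner) =
      of k X + ∑ Y ∈ d.lowerTerms, of k Y := by
  classical
  rw [comp_of]
  exact (Finset.add_sum_erase _ _ (mem_compSet.2 d.isMaxComp.toIsComp)).symm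

section Defect

variable {Q : OperadData.{u, w} k} (φ : ∀ n, (preLie k).obj n →ₗ[k] Q.obj n)

/-- All compositions of trees whose largest term is `X` are preserved by `φ`. -/
def PreservesAt (X : LabelledTree (Fin p)) : Prop :=
  ∀ ⦃n m : ℕ⦄ (h : n + m = p + 1) (T : LabelledTree (Fin n)) (i : Fin n)
    (S : LabelledTree (Fin m)), T.IsMaxComp (blockEquiv h i) S X →
      compDefect φ h i (of k T) (of k S) = 0

variable {φ} {X : LabelledTree (Fin r)}

theorem compDefect_comp_left (ih : ∀ Y < X, PreservesAt φ Y) {hp : n + m = p + 1}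
    {hr : p + l = r + 1} {i : Fin n} {j : Fin p} {A : LabelledTree (Fin n)}
    {B : LabelledTree (Fin m)} {AB : LabelledTree (Fin p)} {C : LabelledTree (Fin l)}
    (hAB : A.IsMaxComp (blockEquiv hp i) B AB) (hX : AB.IsMaxComp (blockEquiv hr j) C X) :
    compDefect φ hr j ((preLie k).comp hp i (of k A) (of k B)) (of k C) =
      compDefect φ hr j (of k AB) (of k C) := by
  rw [comp_of, map_sum, LinearMap.sum_apply]
  refine Finset.sum_eq_single_of_mem AB (mem_compSet.2 hAB.toIsComp) fun AB' hAB' hne => ?_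
  have hmax := isMaxComp_maxComp hr AB' j C
  have hle := hX.le_of_isComp hmax.toIsComp
    (hAB.le_of_isComp (mem_compSet.1 hAB') le_rfl le_rfl) le_rfl
  refine ih _ (hle.lt_of_ne fun heq => hne ?_) hr AB' j C hmax
  exact (hmax.toIsComp.unique (heq ▸ hX.toIsComp)).1

theorem compDefect_comp_right (ih : ∀ Y < X, PreservesAt φ Y) {hq : m + l = q + 1}
    {hr : n + q = r + 1} {i : Fin n} {j : Fin m} {A : LabelledTree (Fin n)}
    {B : LabelledTree (Fin m)} {C : LabelledTree (Fin l)} {BC : LabelledTree (Fin q)}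
    (hBC : B.IsMaxComp (blockEquiv hq j) C BC) (hX : A.IsMaxComp (blockEquiv hr i) BC X) :
    compDefect φ hr i (of k A) ((preLie k).comp hq j (of k B) (of k C)) =
      compDefect φ hr i (of k A) (of k BC) := by
  rw [comp_of, map_sum]
  refine Finset.sum_eq_single_of_mem BC (mem_compSet.2 hBC.toIsComp) fun BC' hBC' hne => ?_
  have hmax := isMaxComp_maxComp hr A i BC'
  have hle := hX.le_of_isComp hmax.toIsComp le_rfl
    (hBC.le_of_isComp (mem_compSet.1 hBC') le_rfl le_rfl)
  refine ih _ (hle.lt_of_ne fun heq => hne ?_) hr A i BC' hmax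
  exact (hmax.toIsComp.unique (heq ▸ hX.toIsComp)).2

variable (hQ : Q.IsOperad) (ihr : ∀ s < r, ∀ Y : LabelledTree (Fin s), PreservesAt φ Y)
  (ihX : ∀ Y < X, PreservesAt φ Y) (d d' : X.MaxDecomp)

include hQ ihr ihX

theorem compDefect_eq_of_nested (hle : (d'.idx : ℕ) ≤ d.idx)
    (hle' : (d.idx + d.m : ℕ) ≤ d'.idx + d'.m) :
    compDefect φ d.arity d.idx (of k d.outer) (of k d.inner) =
      compDefect φ d'.arity d'.idx (of k d'.outer) (of k d'.inner) := by
  have := d.one_lt_inner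
  have hr := d.arity
  have hr' := d'.arity
  obtain ⟨b, hb⟩ : ∃ b, b + d.m = d'.m + 1 := ⟨d'.m + 1 - d.m, by omega⟩
  have hp : d'.n + b = d.n + 1 := by omega
  let j : Fin b := ⟨d.idx - d'.idx, by omega⟩
  have hj : (d.idx : ℕ) = d'.idx + j := (Nat.add_sub_of_le hle).symm
  obtain ⟨B, hB, hAB⟩ := (isNested_blockEquiv hp hr hb hr' hj).exists_isMaxComp
    (strictMono_blockIncl_blockEquiv _ _) (monotone_blockContr_blockEquiv _ _) d'.isMaxComp
    d.isMaxComp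
  have hdefect := compDefect_assoc isOperad hQ hp hr hb hr' hj
    (ihr _ d.outer_lt _ hp _ _ _ hAB) (ihr _ d'.inner_lt _ hb _ _ _ hB)
  rwa [compDefect_comp_left ihX hAB d.isMaxComp, compDefect_comp_right ihX hB d'.isMaxComp]
    at hdefect

theorem compDefect_eq_of_disjoint (hle : (d.idx + d.m : ℕ) ≤ d'.idx) :
    compDefect φ d.arity d.idx (of k d.outer) (of k d.inner) =
      compDefect φ d'.arity d'.idx (of k d'.outer) (of k d'.inner) := by
  have := d.one_lt_inner
  have hr := d.arity
  have hr' := d'.arity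
  obtain ⟨b, hb⟩ : ∃ b, b + d.m = d'.n + 1 := ⟨d'.n + 1 - d.m, by omega⟩
  have hp : b + d'.m = d.n + 1 := by omega
  let i : Fin b := ⟨d'.idx + 1 - d.m, by omega⟩
  let j : Fin b := ⟨d.idx, by omega⟩
  have hji : (j : ℕ) < i := by dsimp only [i, j]; omega
  have hi : (d'.idx : ℕ) + 1 = i + d.m := by dsimp only [i]; omega
  obtain ⟨A, hA, hA'⟩ := (isDisjoint_blockEquiv hp hr hb hr' hji rfl hi).exists_isMaxComp
    (monotone_blockContr_blockEquiv _ _) (monotone_blockContr_blockEquiv _ _) d.isMaxComp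
    d'.isMaxComp
  have hdefect := compDefect_comm isOperad hQ hp hr hb hr' hji rfl hi
    (ihr _ d.outer_lt _ hp _ _ _ hA) (ihr _ d'.outer_lt _ hb _ _ _ hA')
  rwa [compDefect_comp_left ihX hA d.isMaxComp, compDefect_comp_left ihX hA' d'.isMaxComp]
    at hdefect

theorem compDefect_eq :
    compDefect φ d.arity d.idx (of k d.outer) (of k d.inner) =
      compDefect φ d'.arity d'.idx (of k d'.outer) (of k d'.inner) := by
  rcases d.isMaxComp.nested_or_disjoint d'.isMaxComp with h | h | h | h
  · exact (compDefect_eq_of_nested hQ ihr ihX d' d h.1 h.2).symm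
  · exact compDefect_eq_of_nested hQ ihr ihX d d' h.1 h.2
  · exact compDefect_eq_of_disjoint hQ ihr ihX d d' h
  · exact (compDefect_eq_of_disjoint hQ ihr ihX d' d h).symm

end Defect

section Preserves

variable {Q : OperadData.{u, w} k} {φ : ∀ n, (preLie k).obj n →ₗ[k] Q.obj n} (hQ : Q.IsOperad)
  (hone : φ 1 (preLie k).one = Q.one)
  (hdec : ∀ p (X : LabelledTree (Fin p)), X.IsDecomposable →
    ∃ d : X.MaxDecomp, compDefect φ d.arity d.idx (of k d.outer) (of k d.inner) = 0)

include hQ hone hdec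

theorem preservesAt (X : LabelledTree (Fin p)) : PreservesAt φ X := by
  induction p, X using induction_arity_lt with
  | step p X ihp ihX =>
    intro n m h T i S hX
    have hn : 1 ≤ n := T.root.pos
    have hm : 1 ≤ m := S.root.pos
    rcases hn.eq_or_lt with rfl | hn
    · obtain rfl : m = p := by omega
      rw [Subsingleton.elim T default, Subsingleton.elim i 0, ← one_eq]
      exact compDefect_one_left isOperad hQ hone h _
    rcases hm.eq_or_lt with rfl | hm
    · obtain rfl : n = p := by omega
      rw [Subsingleton.elim S default, ← one_eq]
      exact compDefect_one_right isOperad hQ hone h i _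
    · let d : X.MaxDecomp := ⟨n, m, h, T, i, S, hn, hm, hX⟩
      obtain ⟨d', hd'⟩ := hdec p X (nonempty_maxDecomp.1 ⟨d⟩)
      exact (compDefect_eq hQ ihp ihX d d').trans hd'

theorem compDefect_eq_zero (h : n + m = p + 1) (i : Fin n) : compDefect φ h i = 0 :=
  hom_ext fun T => hom_ext fun S =>
    preservesAt hQ hone hdec _ h T i S (isMaxComp_maxComp h T i S)

end Preserves

section Extension

variable (Q : OperadData.{u, w} k) (g : ∀ n, IndecomposableTree n → Q.obj n)

open Classical in
/-- The image of a tree under the morphism that extends `g`. On a decomposable tree `X` it is the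
value for which the composition of one chosen decomposition of `X` is preserved. -/
noncomputable def treeVal (p : ℕ) (X : LabelledTree (Fin p)) : Q.obj p :=
  if hX : Nonempty X.MaxDecomp then
    Q.comp hX.some.arity hX.some.idx (treeVal hX.some.n hX.some.outer)
        (treeVal hX.some.m hX.some.inner) -
      ∑ Y ∈ hX.some.lowerTerms.attach, treeVal p Y.1
  else if hp : p = 1 then hp ▸ Q.one
  else g p ⟨X, by have := X.root.pos; omega, mt nonempty_maxDecomp.2 hX⟩
termination_by (p, {Y | Y < X}.ncard)
decreasing_by
  · exact Prod.Lex.left _ _ hX.some.outer_lt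
  · exact Prod.Lex.left _ _ hX.some.inner_lt
  · exact Prod.Lex.right _ (Set.ncard_lt_ncard
      (Set.Iio_ssubset_Iio (hX.some.lt_of_mem_lowerTerms Y.2)) (Set.toFinite _))

theorem treeVal_of_indecomposable (X : IndecomposableTree p) : treeVal Q g p X.1 = g p X := by
  rw [treeVal, dif_neg (mt nonempty_maxDecomp.1 X.2.2), dif_neg (by have := X.2.1; omega)]
  rfl

theorem treeVal_one (X : LabelledTree (Fin 1)) : treeVal Q g 1 X = Q.one := by
  rw [treeVal, dif_neg fun ⟨d⟩ => d.outer_lt.not_ge d.one_lt_outer.le, dif_pos rfl]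

theorem exists_maxDecomp_treeVal {X : LabelledTree (Fin p)} (hX : X.IsDecomposable) :
    ∃ d : X.MaxDecomp, Q.comp d.arity d.idx (treeVal Q g d.n d.outer) (treeVal Q g d.m d.inner) =
      treeVal Q g p X + ∑ Y ∈ d.lowerTerms, treeVal Q g p Y := by
  have hX' := nonempty_maxDecomp.2 hX
  refine ⟨hX'.some, ?_⟩
  rw [treeVal.eq_1 Q g p X, dif_pos hX', Finset.sum_attach _ (treeVal Q g p), sub_add_cancel]

variable {Q}

theorem lift_treeVal_one : lift (treeVal Q g 1) (preLie k).one = Q.one := by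
  rw [one_eq, lift_of, treeVal_one]

/-- The morphism of operads that extends `g`. -/
noncomputable def extend (hQ : Q.IsOperad) : Hom (preLie k) Q where
  app n := lift (treeVal Q g n)
  map_one := lift_treeVal_one g
  map_comp h i a b := by
    have hzero : compDefect (fun n => lift (treeVal Q g n)) h i = 0 :=
      compDefect_eq_zero hQ (lift_treeVal_one g) (fun p X hX => by
        obtain ⟨d, hd⟩ := exists_maxDecomp_treeVal Q g hX
        refine ⟨d, ?_⟩
        rw [compDefect_apply, comp_maxDecomp, map_add, map_sum, sub_eq_zero]
        simpa only [lift_of] using hd) h i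
    exact (sub_eq_zero.1 (LinearMap.congr_fun₂ hzero a b)).symm

theorem extend_of (hQ : Q.IsOperad) (X : IndecomposableTree n) :
    (extend g hQ).app n (of k X.1) = g n X :=
  (lift_of _ X.1).trans (treeVal_of_indecomposable Q g X)

end Extension

theorem hom_eq_of_indecomposable {Q : OperadData.{u, w} k} (φ ψ : Hom (preLie k) Q)
    (h : ∀ n (X : IndecomposableTree n), φ.app n (of k X.1) = ψ.app n (of k X.1)) : φ = ψ := by
  suffices htree : ∀ p (X : LabelledTree (Fin p)), φ.app p (of k X) = ψ.app p (of k X) from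
    Hom.ext (funext fun p => hom_ext (htree p))
  intro p X
  induction p, X using induction_arity_lt with
  | step p X ihp ihX =>
    by_cases hX : X.IsDecomposable
    · obtain ⟨d⟩ := nonempty_maxDecomp.2 hX
      have hcomp := (φ.map_comp d.arity d.idx (of k d.outer) (of k d.inner)).trans
        (.trans (by rw [ihp _ d.outer_lt, ihp _ d.inner_lt])
          (ψ.map_comp d.arity d.idx (of k d.outer) (of k d.inner)).symm)
      rw [comp_maxDecomp, map_add, map_add, map_sum, map_sum,
        Finset.sum_congr rfl fun Y hY => ihX Y (d.lt_of_mem_lowerTerms hY)] at hcomp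
      exact add_right_cancel hcomp
    · rcases X.root.pos.nat_succ_le.eq_or_lt with rfl | hp
      · rw [Subsingleton.elim X default, ← one_eq, φ.map_one, ψ.map_one]
      · exact h p ⟨X, hp, hX⟩

end preLie

theorem mainTheorem1 (k : Type u) [Field k] :
    (preLie k).IsReduced ∧
      OperadData.IsFreeOn.{u, w} (preLie k) (X := IndecomposableTree)
        (fun _ X => Finsupp.single X.1 1) := by
  refine ⟨preLie.isReduced, preLie.isOperad, fun Q hQ g => ⟨preLie.extend g hQ, ?_, ?_⟩⟩
  · exact fun n X => preLie.extend_of g hQ X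
  · intro ψ hψ
    refine preLie.hom_eq_of_indecomposable _ _ fun n X => ?_
    exact (hψ n X).trans (preLie.extend_of g hQ X).symm
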